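/- Let $H$ be an infinite-dimensional separable real Hilbert space, $\Psi:H\to H$ a bounded linear operator, and let $\{X_n\}_{n\ge1}$ be an $H$-valued ARH(1) process, $X_{n+1}=\Psi(X_n)+\varepsilon_{n+1}$ for $n\ge 1$, with Hilbert–Schmidt norm $\|\Psi\|_{\mathcal S}=\big(\sum_k\|\Psi(e_k)\|^2\big)^{1/2}<1$ ($\{e_k\}$ any orthonormal basis). Write $(x\otimes y)(z)=\langle x,z\rangle y$. A sequence $\{Z_n\}_{n\ge1}$ of random elements with $E\|Z_n\|^4<\infty$ is called $L^4$–$m$–approximable if $Z_n=f(\delta_n,\delta_{n-1},\dots)$ with i.i.d. $\delta_i$, $i\in\mathbb Z$, in a measurable space $S$ and a measurable $f:S^\infty\to H$, such that $\sum_{m\ge1}\big(E\|Z_m-Z_m^{(m)}\|^4\big)^{1/4}<\infty$, where $Z_n^{(m)}=f(\delta_n,\dots,\delta_{n-m+1},\delta'_{n-m},\delta'_{n-m-1},\dots)$ and $\{\delta_i'\}$ is an independent copy of $\{\delta_i\}$ (on an enlarged probability space, if necessary). $H$-white noise is a sequence of square integrable, pairwise orthogonal ($E[Z_i\otimes Z_j]=0$,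 $i\ne j$) random elements with constant mean and constant covariance operator. Assume (A), where the errors of the regression of $X_{k+1}$ on $X_k$ are $\varepsilon_{k+1}$: the sequences $\{X_k\}_{k\ge1}$ and $\{\varepsilon_{k+1}\}_{k\ge1}$ have zero mean and are $L^4$–$m$–approximable, $\{\varepsilon_{k+1}\}_{k\ge 1}$ is $H$-white noise, and $E[X_k\otimes\varepsilon_{k+1}]=0$ for all $k\ge1$. Assume that the covariance operator $C=E[X_1\otimes X_1]$ has full rank ($\overline{\mathrm{Im}(C)}=H$), and that its eigenvalues $\lambda_1\ge\lambda_2\ge\dots$, listed with multiplicity, are mutually distinct. Let $\hat C_n=\frac1n\sum_{k=1}^nX_k\otimes X_k$ and $\hat\Delta_n=\frac1n\sum_{k=1}^nX_k\otimes X_{k+1}$, let $\hat\lambda_1\ge\hat\lambda_2\ge\dots$ be the eigenvalues of $\hat C_n$ with multiplicity and $\hat v_1,\hat v_2,\dots$ corresponding orthonormal eigenvectors (any choice), and put $\hat\alpha_1=\hat\lambda_1-\hat\lambda_2$, $\hat\alpha_j=\min\{\hat\lambda_{j-1}-\hat\lambda_j,\hat\lambda_j-\hat\lambda_{j+1}\}$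 for $j>1$. Let (K) hold: $m_n$ are real numbers with $m_n\to\infty$ and $m_n^6=o(n)$, and $K_n=\min(B_n,E_n,\lfloor m_n\rfloor)$ with $B_n=\max\{j\ge1:\hat\lambda_j^{-1}\le m_n\}$, $E_n=\max\{k\ge1:\max_{1\le j\le k}\hat\alpha_j^{-1}\le m_n\}$, where $0^{-1}=\infty$ and the maximum of the empty set is $0$. Then the estimator $$\hat\Psi_{K_n}(x)=\sum_{j=1}^{K_n}\frac{\hat\Delta_n(\hat v_j)}{\hat\lambda_j}\langle\hat v_j,x\rangle$$ is weakly consistent for $\Psi$ in operator norm: $\|\hat\Psi_{K_n}-\Psi\|_{\mathcal L(H)}\to0$ in probability as $n\to\infty$. -/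

import Mathlib

open MeasureTheory ProbabilityTheory Filter Topology
open scoped ENNReal

universe u v w w₁ w₂

namespace HilbertRegression

noncomputable section

section Operators

variable {H₁ : Type u} [NormedAddCommGroup H₁] [InnerProductSpace ℝ H₁]
variable {H₂ : Type v} [NormedAddCommGroup H₂] [InnerProductSpace ℝ H₂]

/-- The operator `x ⊗ y : H₁ → H₂`, `(x ⊗ y)(z) = ⟨x, z⟩ y`. -/
def tensor (x : H₁) (y : H₂) : H₁ →L[ℝ] H₂ :=
  InnerProductSpace.rankOne ℝ y x

theorem tensor_apply (x z : H₁) (y : H₂) : tensor x y z = (inner ℝ x z : ℝ) • y := rfl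

/-- The Hilbert-Schmidt norm `(∑ ‖Φ eᵢ‖²)^{1/2}` (possibly `∞`) with respect to some orthonormal
basis of `H₁`; by `hilbertSchmidtNorm_eq` below the basis does not matter. -/
def hilbertSchmidtNorm [CompleteSpace H₁] (Φ : H₁ →L[ℝ] H₂) : ℝ≥0∞ :=
  (∑' i, ‖Φ ((exists_hilbertBasis ℝ H₁).choose_spec.choose i)‖ₑ ^ 2) ^ (1 / 2 : ℝ)

theorem enorm_sq_eq_tsum {ι : Type*} (b : HilbertBasis ι ℝ H₁) (x : H₁) :
    ‖x‖ₑ ^ 2 = ∑' i, ‖(inner ℝ (b i) x : ℝ)‖ₑ ^ 2 := by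
  have h := b.hasSum_inner_mul_inner x x
  have h2 : ∀ i, (inner ℝ x (b i) : ℝ) * inner ℝ (b i) x = (inner ℝ (b i) x : ℝ) ^ 2 := by
    intro i
    rw [real_inner_comm]
    ring
  simp only [h2] at h
  rw [real_inner_self_eq_norm_sq] at h
  have h3 : ∀ i, ‖(inner ℝ (b i) x : ℝ)‖ₑ ^ 2 = ENNReal.ofReal ((inner ℝ (b i) x : ℝ) ^ 2) := by
    intro i
    rw [← ofReal_norm, ← ENNReal.ofReal_pow (norm_nonneg _), Real.norm_eq_abs, sq_abs]
  simp only [h3]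
  rw [← ENNReal.ofReal_tsum_of_nonneg (fun i => sq_nonneg _) h.summable, h.tsum_eq,
    ENNReal.ofReal_pow (norm_nonneg _), ofReal_norm]

theorem tsum_enorm_sq_eq_adjoint [CompleteSpace H₁] [CompleteSpace H₂] {ι κ : Type*}
    (b : HilbertBasis ι ℝ H₁) (c : HilbertBasis κ ℝ H₂) (Φ : H₁ →L[ℝ] H₂) :
    ∑' i, ‖Φ (b i)‖ₑ ^ 2 = ∑' j, ‖ContinuousLinearMap.adjoint Φ (c j)‖ₑ ^ 2 := by
  simp only [enorm_sq_eq_tsum c, enorm_sq_eq_tsum b]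
  rw [ENNReal.tsum_comm]
  refine tsum_congr fun j => tsum_congr fun i => ?_
  rw [ContinuousLinearMap.adjoint_inner_right, real_inner_comm]

theorem hilbertSchmidtNorm_eq [CompleteSpace H₁] [CompleteSpace H₂] {ι : Type*}
    (b : HilbertBasis ι ℝ H₁) (Φ : H₁ →L[ℝ] H₂) :
    hilbertSchmidtNorm Φ = (∑' i, ‖Φ (b i)‖ₑ ^ 2) ^ (1 / 2 : ℝ) := by
  have c := (exists_hilbertBasis ℝ H₂).choose_spec.choose
  rw [hilbertSchmidtNorm, tsum_enorm_sq_eq_adjoint _ c, tsum_enorm_sq_eq_adjoint b c]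

/-- `lam` and `v` list the eigenvalues (in decreasing order, according to multiplicity) and
orthonormal eigenvectors of a positive compact operator `T`: those eigenvectors that belong to a
non-zero eigenvalue form an orthonormal basis of the closure of the image of `T`.
The indexing starts at `0`: `lam j` is the `(j+1)`-st largest eigenvalue. -/
structure IsEigensystem (T : H₁ →L[ℝ] H₁) (lam : ℕ → ℝ) (v : ℕ → H₁) : Prop where
  antitone : Antitone lam
  orthonormal : Orthonormal ℝ v
  apply_eq : ∀ j, T (v j) = lam j • v j
  closure_span : (Submodule.span ℝ {x | ∃ j, lam j ≠ 0 ∧ x = v j}).topologicalClosure =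
    (LinearMap.range (T : H₁ →ₗ[ℝ] H₁)).topologicalClosure

end Operators

section Selection

/-- The spectral gaps: `α₁ = λ₁ - λ₂` and `αⱼ = min {λⱼ₋₁ - λⱼ, λⱼ - λⱼ₊₁}` for `j > 1`
(indexing from `0`, so that `spectralGap lam j` is the `(j+1)`-st gap). -/
def spectralGap (lam : ℕ → ℝ) : ℕ → ℝ
  | 0 => lam 0 - lam 1
  | j + 1 => min (lam j - lam (j + 1)) (lam (j + 1) - lam (j + 2))

/-- `B = max {j ≥ 1 | λⱼ⁻¹ ≤ m}`, where `0⁻¹ = ∞`; it is `0` if there is no such `j`. -/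
def indexB (lam : ℕ → ℝ) (m : ℝ) : ℕ :=
  sSup {k : ℕ | ∃ j, k = j + 1 ∧ 0 < lam j ∧ (lam j)⁻¹ ≤ m}

/-- `E = max {k ≥ 1 | max_{1 ≤ j ≤ k} αⱼ⁻¹ ≤ m}`, where `0⁻¹ = ∞`; it is `0` if there is no such
`k`. -/
def indexE (lam : ℕ → ℝ) (m : ℝ) : ℕ :=
  sSup {k : ℕ | 1 ≤ k ∧ ∀ j < k, 0 < spectralGap lam j ∧ (spectralGap lam j)⁻¹ ≤ m}

/-- The truncation level `K = min (B, E, m)`, as an integer. -/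
def truncationLevel (lam : ℕ → ℝ) (m : ℝ) : ℕ :=
  min (min (indexB lam m) (indexE lam m)) ⌊m⌋₊

end Selection

section Probability

variable {Ω : Type u} [MeasurableSpace Ω]

/-- Given `X_n = f (δ_n, δ_{n-1}, …)`, the random variable
`X_n^{(m)} = f (δ_n, …, δ_{n-m+1}, δ'_{n-m}, δ'_{n-m-1}, …)`. It lives on `Ω × Ω`, where
`δ i` is evaluated at the first coordinate and its copy `δ' i` is `δ i` evaluated at the second
coordinate, so that under `P.prod P` the `δ'` are independent copies of the `δ`. -/
def coupled {S : Type w} {H : Type v} (f : (ℕ → S) → H) (δ : ℤ → Ω → S) (n m : ℕ)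
    (z : Ω × Ω) : H :=
  f fun k => if k < m then δ ((n : ℤ) - k) z.1 else δ ((n : ℤ) - k) z.2

variable {H : Type v} [NormedAddCommGroup H] [InnerProductSpace ℝ H]
  [MeasurableSpace H]

/-- `L^p`-`m`-approximability of a sequence `(X_n)_{n ≥ 1}` in `L^p` (the value `X 0` is not
used). -/
def LpMApproximable (p : ℝ≥0∞) (X : ℕ → Ω → H) (P : Measure Ω) : Prop :=
  (∀ n, 1 ≤ n → MemLp (X n) p P) ∧
  ∃ (S : Type w) (_ : MeasurableSpace S) (δ : ℤ → Ω → S) (f : (ℕ → S) → H),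
    (∀ i, Measurable (δ i)) ∧ iIndepFun δ P ∧ (∀ i, IdentDistrib (δ i) (δ 0) P P) ∧
    Measurable f ∧
    (∀ n : ℕ, 1 ≤ n → X n =ᵐ[P] fun ω => f fun k : ℕ => δ ((n : ℤ) - k) ω) ∧
    ∑' m : ℕ, eLpNorm (fun z : Ω × Ω => X (m + 1) z.1 - coupled f δ (m + 1) (m + 1) z) p
      (P.prod P) < ∞

/-- The covariance operator `E[(X - μ) ⊗ (X - μ)]`, `μ = E X`. -/
def covOperator (X : Ω → H) (P : Measure Ω) : H →L[ℝ] H :=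
  ∫ ω, tensor (X ω - ∫ ω', X ω' ∂P) (X ω - ∫ ω', X ω' ∂P) ∂P

/-- Orthogonality `X ⊥ Y`, i.e. `E[X ⊗ Y] = 0`. -/
def Orthogonal {H₁ : Type v} [NormedAddCommGroup H₁] [InnerProductSpace ℝ H₁]
    {H₂ : Type w} [NormedAddCommGroup H₂] [InnerProductSpace ℝ H₂]
    (X : Ω → H₁) (Y : Ω → H₂) (P : Measure Ω) : Prop :=
  ∫ ω, tensor (X ω) (Y ω) ∂P = 0

/-- `(e_k)_{k ≥ 1}` is `H`-white noise: square integrable and pairwise orthogonal, with constant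
mean and constant covariance operator. -/
structure IsWhiteNoise (e : ℕ → Ω → H) (P : Measure Ω) : Prop where
  memLp : ∀ k, 1 ≤ k → MemLp (e k) 2 P
  mean_eq : ∀ k, 1 ≤ k → ∫ ω, e k ω ∂P = ∫ ω, e 1 ω ∂P
  cov_eq : ∀ k, 1 ≤ k → covOperator (e k) P = covOperator (e 1) P
  orthogonal : ∀ i j, 1 ≤ i → 1 ≤ j → i ≠ j → Orthogonal (e i) (e j) P

/-- Assumption (A) on the regressors `(X_k)_{k ≥ 1}` in `H₁` and the errors `(e_k)_{k ≥ 1}` in `H₂`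
of the linear model `Y_k = Ψ X_k + e_k`. -/
structure AssumptionA {H₁ : Type v} [NormedAddCommGroup H₁] [InnerProductSpace ℝ H₁]
    [MeasurableSpace H₁] {H₂ : Type w} [NormedAddCommGroup H₂] [InnerProductSpace ℝ H₂]
    [MeasurableSpace H₂] (X : ℕ → Ω → H₁) (e : ℕ → Ω → H₂) (P : Measure Ω) : Prop where
  mean_X : ∀ k, 1 ≤ k → ∫ ω, X k ω ∂P = 0
  mean_e : ∀ k, 1 ≤ k → ∫ ω, e k ω ∂P = 0
  approximable_X : LpMApproximable.{u, v, w₁} 4 X P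
  approximable_e : LpMApproximable.{u, w, w₂} 4 e P
  whiteNoise : IsWhiteNoise e P
  orthogonal : ∀ k, 1 ≤ k → Orthogonal (X k) (e k) P

/-- `(X_n)_{n ≥ 1}` solves the ARH(1) recursion `X_{n+1} = Ψ X_n + ε_{n+1}`, `n ≥ 1`, almost
surely. -/
def IsARH1 (Ψ : H →L[ℝ] H) (X ε : ℕ → Ω → H) (P : Measure Ω) : Prop :=
  ∀ n, 1 ≤ n → ∀ᵐ ω ∂P, X (n + 1) ω = Ψ (X n ω) + ε (n + 1) ω

end Probability

section Estimator

variable {Ω : Type w} {H₁ : Type u} [NormedAddCommGroup H₁] [InnerProductSpace ℝ H₁]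
variable {H₂ : Type v} [NormedAddCommGroup H₂] [InnerProductSpace ℝ H₂]

/-- `n⁻¹ ∑_{k=1}^n X_k ⊗ Y_k`. With `Y = X` this is the empirical covariance operator. -/
def empiricalCross (X : ℕ → Ω → H₁) (Y : ℕ → Ω → H₂) (n : ℕ) (ω : Ω) : H₁ →L[ℝ] H₂ :=
  (n : ℝ)⁻¹ • ∑ k ∈ Finset.Icc 1 n, tensor (X k ω) (Y k ω)

/-- The principal components estimator `x ↦ ∑_{j=1}^K λⱼ⁻¹ ⟨vⱼ, x⟩ Δ(vⱼ)`, built from eigenvalues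
`lam`, eigenvectors `v` and a cross covariance operator `D`. -/
def pcEstimator (D : H₁ →L[ℝ] H₂) (lam : ℕ → ℝ) (v : ℕ → H₁) (K : ℕ) : H₁ →L[ℝ] H₂ :=
  ∑ j ∈ Finset.range K, tensor (v j) ((lam j)⁻¹ • D (v j))

end Estimator

end

end HilbertRegression

open HilbertRegression

/-!
Write `Y_k = X_{k+1}`, `Ĉ` and `Δ̂` for the empirical operators, `Π` for the projection onto the
first `K` empirical eigenvectors and `R̂` for the empirical cross moment of the regressors and the
errors, so that `Δ̂ = Ψ Ĉ + R̂` and the estimator equals `Ψ Π + R̂ Ĉ⁻¹ Π`. As `λ̂_j ≥ 1 / m` for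
`j ≤ K`, the second term has norm at most `m ‖R̂‖`. For the first one, `Ψ` is a Hilbert-Schmidt
operator, hence a limit of `Ψ Π_N` with population projections `Π_N`; once `Ĉ` is close to `C` and
`m` is large, the separation of the first `N` population eigenvalues forces `K ≥ N` and makes `Π`
almost the identity on the range of `Π_N`.

Both `Ĉ - C` and `R̂` are averages of a stationary sequence with mean zero, so it remains to see
that such averages are `O(n^{-1/2})` in `L¹`. Subtract from each term its value at an independent
copy of the innovations. Swapping the two copies up to a fixed time reverses the sign of the earlier
terms, and by approximability it changes the later ones little: the differences are almost
orthogonal.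
-/

namespace HilbertRegression

section HilbertSchmidt

variable {H : Type u} [NormedAddCommGroup H] [InnerProductSpace ℝ H]

theorem norm_le_mul_norm_of_abs_inner_le {ι : Type*} (b : HilbertBasis ι ℝ H) {x y : H} {c : ℝ}
    (hc : 0 ≤ c) (h : ∀ i, |(inner ℝ (b i) y : ℝ)| ≤ c * |(inner ℝ (b i) x : ℝ)|) :
    ‖y‖ ≤ c * ‖x‖ := by
  suffices ‖y‖ₑ ^ 2 ≤ (ENNReal.ofReal c * ‖x‖ₑ) ^ 2 by
    rw [ENNReal.pow_le_pow_left_iff two_ne_zero] at this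
    rwa [← ofReal_norm, ← ofReal_norm, ← ENNReal.ofReal_mul hc,
      ENNReal.ofReal_le_ofReal_iff (by positivity)] at this
  rw [mul_pow, enorm_sq_eq_tsum b, enorm_sq_eq_tsum b, ← ENNReal.tsum_mul_left]
  refine ENNReal.tsum_le_tsum fun i => ?_
  rw [← mul_pow]
  gcongr
  rw [← ofReal_norm, ← ofReal_norm, ← ENNReal.ofReal_mul hc]
  exact ENNReal.ofReal_le_ofReal (h i)

variable [CompleteSpace H] {G : Type v} [NormedAddCommGroup G] [InnerProductSpace ℝ G]
  [CompleteSpace G]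

theorem hilbertSchmidtNorm_sq {ι : Type*} (b : HilbertBasis ι ℝ H) (Φ : H →L[ℝ] G) :
    hilbertSchmidtNorm Φ ^ 2 = ∑' i, ‖Φ (b i)‖ₑ ^ 2 := by
  rw [hilbertSchmidtNorm_eq b, ← ENNReal.rpow_mul_natCast]
  norm_num

theorem enorm_le_hilbertSchmidtNorm (Φ : H →L[ℝ] G) : ‖Φ‖ₑ ≤ hilbertSchmidtNorm Φ := by
  obtain ⟨_, b, -⟩ := exists_hilbertBasis ℝ H
  suffices hadj : ‖Φ.adjoint‖ₑ ≤ hilbertSchmidtNorm Φ by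
    rwa [← ofReal_norm, LinearIsometryEquiv.norm_map, ofReal_norm] at hadj
  refine ContinuousLinearMap.opENorm_le_bound _ fun y => ?_
  rw [← ENNReal.pow_le_pow_left_iff two_ne_zero, mul_pow, hilbertSchmidtNorm_sq b,
    enorm_sq_eq_tsum b, ← ENNReal.tsum_mul_right]
  refine ENNReal.tsum_le_tsum fun i => ?_
  rw [ContinuousLinearMap.adjoint_inner_right, ← mul_pow]
  gcongr
  simp only [enorm_eq_nnnorm]
  exact_mod_cast nnnorm_inner_le_nnnorm (𝕜 := ℝ) (Φ (b i)) y

end HilbertSchmidt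

section SpanProj

variable {H : Type u} [NormedAddCommGroup H] [InnerProductSpace ℝ H] {v : ℕ → H}

/-- The orthogonal projection onto the span of the first `K` vectors of an orthonormal sequence
`v`. It is encoded as a sum of rank one operators, so that it makes sense for every `v`. -/
noncomputable def spanProj (v : ℕ → H) (K : ℕ) : H →L[ℝ] H :=
  ∑ j ∈ Finset.range K, tensor (v j) (v j)

theorem spanProj_apply (v : ℕ → H) (K : ℕ) (x : H) :
    spanProj v K x = ∑ j ∈ Finset.range K, (inner ℝ (v j) x : ℝ) • v j := by
  simp [spanProj, tensor_apply]

theorem spanProj_apply_basis (hv : Orthonormal ℝ v) (K i : ℕ) :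
    spanProj v K (v i) = if i < K then v i else 0 := by
  simp [spanProj_apply, orthonormal_iff_ite.1 hv]

theorem inner_sub_spanProj (hv : Orthonormal ℝ v) {K i : ℕ} (hi : i < K) (x : H) :
    (inner ℝ (v i) (x - spanProj v K x) : ℝ) = 0 := by
  rw [inner_sub_right, spanProj_apply, hv.inner_right_sum _ (Finset.mem_range.2 hi), sub_self]

theorem inner_spanProj_left (v : ℕ → H) (K : ℕ) (x y : H) :
    (inner ℝ (spanProj v K x) y : ℝ) = inner ℝ x (spanProj v K y) := by
  simp only [spanProj_apply, sum_inner, inner_sum, real_inner_smul_left, real_inner_smul_right]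
  refine Finset.sum_congr rfl fun i _ => ?_
  rw [real_inner_comm x (v i), mul_comm]

theorem norm_sub_spanProj_le (hv : Orthonormal ℝ v) (K : ℕ) (x : H) :
    ‖x - spanProj v K x‖ ≤ ‖x‖ := by
  have horth : (inner ℝ (spanProj v K x) (x - spanProj v K x) : ℝ) = 0 := by
    rw [spanProj_apply, sum_inner]
    refine Finset.sum_eq_zero fun i hi => ?_
    rw [real_inner_smul_left, ← spanProj_apply, inner_sub_spanProj hv (Finset.mem_range.1 hi),
      mul_zero]
  have hpyth := norm_add_sq_real (spanProj v K x) (x - spanProj v K x)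
  rw [horth, add_sub_cancel] at hpyth
  exact le_of_sq_le_sq (by nlinarith) (norm_nonneg x)

theorem norm_sub_comp_spanProj_le (Φ : H →L[ℝ] H) {v w : ℕ → H} (hv : Orthonormal ℝ v)
    (hw : Orthonormal ℝ w) (N K : ℕ) :
    ‖Φ - Φ ∘L spanProj w K‖ ≤ ‖Φ - Φ ∘L spanProj v N‖ +
      ‖Φ‖ * ∑ j ∈ Finset.range N, ‖v j - spanProj w K (v j)‖ := by
  refine ContinuousLinearMap.opNorm_le_bound _ (by positivity) fun x => ?_
  set y := x - spanProj w K x with hy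
  have hsplit : (Φ - Φ ∘L spanProj w K) x = (Φ - Φ ∘L spanProj v N) y + Φ (spanProj v N y) := by
    simp [hy]
  have hproj : ‖spanProj v N y‖ ≤ (∑ j ∈ Finset.range N, ‖v j - spanProj w K (v j)‖) * ‖x‖ := by
    rw [spanProj_apply, Finset.sum_mul]
    refine norm_sum_le_of_le _ fun j _ => ?_
    rw [norm_smul, hv.1 j, mul_one, hy, inner_sub_right, ← inner_spanProj_left, ← inner_sub_left]
    exact norm_inner_le_norm _ _
  calc ‖(Φ - Φ ∘L spanProj w K) x‖
      ≤ ‖Φ - Φ ∘L spanProj v N‖ * ‖y‖ + ‖Φ‖ * ‖spanProj v N y‖ := by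
        rw [hsplit]
        exact norm_add_le_of_le (ContinuousLinearMap.le_opNorm _ _)
          (ContinuousLinearMap.le_opNorm _ _)
    _ ≤ ‖Φ - Φ ∘L spanProj v N‖ * ‖x‖ +
        ‖Φ‖ * ((∑ j ∈ Finset.range N, ‖v j - spanProj w K (v j)‖) * ‖x‖) := by
        gcongr
        exact norm_sub_spanProj_le hw K x
    _ = _ := by ring

theorem tendsto_comp_spanProj [CompleteSpace H] (b : HilbertBasis ℕ ℝ H)
    {Φ : H →L[ℝ] H} (hΦ : hilbertSchmidtNorm Φ < ∞) :
    Tendsto (fun N => Φ ∘L spanProj b N) atTop (𝓝 Φ) := by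
  have htail : Tendsto (fun N => (∑' k, ‖Φ (b (k + N))‖ₑ ^ 2) ^ (1 / 2 : ℝ)) atTop (𝓝 0) := by
    have hsum := hilbertSchmidtNorm_sq b Φ ▸ (ENNReal.pow_lt_top hΦ).ne
    simpa using (ENNReal.tendsto_sum_nat_add _ hsum).ennrpow_const (1 / 2)
  refine tendsto_iff_edist_tendsto_0.2 (tendsto_of_tendsto_of_tendsto_of_le_of_le
    tendsto_const_nhds htail (fun _ => zero_le) fun N => ?_)
  have hhead : ∀ i ∈ Finset.range N, ‖(Φ - Φ ∘L spanProj b N) (b i)‖ₑ ^ 2 = 0 := fun i hi => by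
    simp [spanProj_apply_basis b.orthonormal, Finset.mem_range.1 hi]
  calc edist (Φ ∘L spanProj b N) Φ ≤ hilbertSchmidtNorm (Φ - Φ ∘L spanProj b N) := by
        rw [edist_comm, edist_eq_enorm_sub]
        exact enorm_le_hilbertSchmidtNorm _
    _ = (∑' k, ‖Φ (b (k + N))‖ₑ ^ 2) ^ (1 / 2 : ℝ) := by
        rw [hilbertSchmidtNorm_eq b, ← ENNReal.summable.sum_add_tsum_nat_add',
          Finset.sum_eq_zero hhead, zero_add]
        simp [spanProj_apply_basis b.orthonormal]

end SpanProj

section Spectral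

variable {H : Type u} [NormedAddCommGroup H] [InnerProductSpace ℝ H]
  {T S : H →L[ℝ] H} {lam mu : ℕ → ℝ} {v w : ℕ → H}

namespace IsEigensystem

theorem nonneg (h : IsEigensystem T lam v) (hT : T.IsPositive) (j : ℕ) : 0 ≤ lam j := by
  have := hT.inner_nonneg_left (v j)
  rwa [h.apply_eq, real_inner_smul_left, real_inner_self_eq_norm_sq, h.orthonormal.1 j, one_pow,
    mul_one] at this

theorem apply_spanProj (h : IsEigensystem T lam v) (hT : (T : H →ₗ[ℝ] H).IsSymmetric)
    (K : ℕ) (x : H) :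
    T (spanProj v K x) = spanProj v K (T x) := by
  simp only [spanProj_apply, map_sum, map_smul]
  refine Finset.sum_congr rfl fun j _ => ?_
  rw [← ContinuousLinearMap.coe_coe, ← hT, ContinuousLinearMap.coe_coe, h.apply_eq,
    real_inner_smul_left, smul_smul, mul_comm]

theorem apply_eq_zero (h : IsEigensystem T lam v) (hT : (T : H →ₗ[ℝ] H).IsSymmetric) {x : H}
    (hx : ∀ j, (inner ℝ (v j) x : ℝ) = 0) : T x = 0 := by
  have hmem : T (T x) ∈ (Submodule.span ℝ {x | ∃ j, lam j ≠ 0 ∧ x = v j}).topologicalClosure := by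
    rw [h.closure_span]
    exact Submodule.le_topologicalClosure _ ⟨T x, rfl⟩
  have hle : (Submodule.span ℝ {x | ∃ j, lam j ≠ 0 ∧ x = v j}).topologicalClosure ≤
      (innerSL ℝ x).ker := by
    refine Submodule.topologicalClosure_minimal _ (Submodule.span_le.2 ?_)
      (ContinuousLinearMap.isClosed_ker _)
    rintro _ ⟨j, -, rfl⟩
    exact (real_inner_comm _ _).trans (hx j)
  have hinner : (inner ℝ x (T (T x)) : ℝ) = 0 := hle hmem
  rwa [← ContinuousLinearMap.coe_coe, ← hT, inner_self_eq_zero] at hinner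

theorem exists_hilbertBasis [CompleteSpace H] (h : IsEigensystem T lam v)
    (hT : (T : H →ₗ[ℝ] H).IsSymmetric) :
    ∃ (s : Set H) (b : HilbertBasis s ℝ H), ∀ i, (∃ j, b i = v j) ∨ T (b i) = 0 := by
  obtain ⟨s, b, hs, hb⟩ := h.orthonormal.toSubtypeRange.exists_hilbertBasis_extension
  refine ⟨s, b, fun i => or_iff_not_imp_left.2 fun hi => h.apply_eq_zero hT fun j => ?_⟩
  have hj : v j = b ⟨v j, hs ⟨j, rfl⟩⟩ := by rw [hb]
  rw [hj]
  exact b.orthonormal.2 fun hij => hi ⟨j, hij ▸ hj.symm⟩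

theorem norm_apply_le [CompleteSpace H] (h : IsEigensystem T lam v) (hT : T.IsPositive) {j : ℕ}
    {x : H} (hx : ∀ i < j, (inner ℝ (v i) x : ℝ) = 0) : ‖T x‖ ≤ lam j * ‖x‖ := by
  obtain ⟨s, b, hb⟩ := h.exists_hilbertBasis hT.isSymmetric
  refine norm_le_mul_norm_of_abs_inner_le b (h.nonneg hT j) fun i => ?_
  rw [← hT.inner_left_eq_inner_right]
  rcases hb i with ⟨k, hk⟩ | hk
  · rw [hk, h.apply_eq, real_inner_smul_left, abs_mul, abs_of_nonneg (h.nonneg hT k)]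
    rcases lt_or_ge k j with hkj | hjk
    · simp [hx k hkj]
    · gcongr
      exact h.antitone hjk
  · rw [hk, inner_zero_left, abs_zero]
    exact mul_nonneg (h.nonneg hT j) (abs_nonneg _)

theorem mul_norm_sq_le_inner (h : IsEigensystem S mu w) {j : ℕ} {x : H}
    (hx : spanProj w (j + 1) x = x) : mu j * ‖x‖ ^ 2 ≤ inner ℝ (S x) x := by
  have hnorm : ‖x‖ ^ 2 = ∑ k ∈ Finset.range (j + 1), (inner ℝ (w k) x : ℝ) ^ 2 := by
    rw [← real_inner_self_eq_norm_sq]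
    nth_rw 1 [← hx]
    simp [spanProj_apply, sum_inner, real_inner_smul_left, sq]
  have hinner : (inner ℝ (S x) x : ℝ) =
      ∑ k ∈ Finset.range (j + 1), mu k * (inner ℝ (w k) x : ℝ) ^ 2 := by
    nth_rw 1 [← hx]
    simp [spanProj_apply, sum_inner, real_inner_smul_left, h.apply_eq, sq, mul_left_comm]
  rw [hnorm, hinner, Finset.mul_sum]
  gcongr with k hk
  exact h.antitone (Finset.mem_range_succ_iff.1 hk)

end IsEigensystem

theorem exists_ne_zero_spanProj_eq_self (hw : Orthonormal ℝ w) (v : ℕ → H) (j : ℕ) :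
    ∃ x ≠ 0, spanProj w (j + 1) x = x ∧ ∀ i < j, (inner ℝ (v i) x : ℝ) = 0 := by
  let E := Submodule.span ℝ (Set.range fun k : Fin (j + 1) => w k)
  let F : E →ₗ[ℝ] (Fin j → ℝ) := LinearMap.pi fun i => innerₗ H (v i) ∘ₗ E.subtype
  have hE : Module.finrank ℝ E = j + 1 :=
    (finrank_span_eq_card (hw.linearIndependent.comp _ Fin.val_injective)).trans
      (Fintype.card_fin _)
  have : FiniteDimensional ℝ E := Module.finite_of_finrank_eq_succ hE
  obtain ⟨x, hx, hx0⟩ := Submodule.exists_mem_ne_zero_of_ne_bot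
    (F.ker_ne_bot_of_finrank_lt (by simp [hE]))
  refine ⟨x, by simpa using hx0, ?_, fun i hi => congrFun (LinearMap.mem_ker.1 hx) ⟨i, hi⟩⟩
  have hle : E ≤ LinearMap.eqLocus (spanProj w (j + 1) : H →ₗ[ℝ] H) LinearMap.id := by
    refine Submodule.span_le.2 ?_
    rintro _ ⟨k, rfl⟩
    exact (spanProj_apply_basis hw _ _).trans (if_pos k.2)
  exact hle x.2

namespace IsEigensystem

variable [CompleteSpace H]

/-- Weyl's inequality, by the min-max argument. -/
theorem le_add_norm_sub (hS : IsEigensystem S mu w) (hT : IsEigensystem T lam v)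
    (hTpos : T.IsPositive) (j : ℕ) : mu j ≤ lam j + ‖S - T‖ := by
  obtain ⟨x, hx0, hxw, hxv⟩ := exists_ne_zero_spanProj_eq_self hS.orthonormal v j
  have hSx : ‖S x‖ ≤ lam j * ‖x‖ + ‖S - T‖ * ‖x‖ := by
    rw [show S x = T x + (S - T) x by simp]
    exact norm_add_le_of_le (hT.norm_apply_le hTpos hxv) (ContinuousLinearMap.le_opNorm _ _)
  refine le_of_mul_le_mul_right ?_ (pow_pos (norm_pos_iff.2 hx0) 2)
  calc mu j * ‖x‖ ^ 2 ≤ inner ℝ (S x) x := hS.mul_norm_sq_le_inner hxw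
    _ ≤ ‖S x‖ * ‖x‖ := real_inner_le_norm _ _
    _ ≤ (lam j * ‖x‖ + ‖S - T‖ * ‖x‖) * ‖x‖ := by gcongr
    _ = (lam j + ‖S - T‖) * ‖x‖ ^ 2 := by ring

theorem abs_sub_le_norm_sub (hS : IsEigensystem S mu w) (hSpos : S.IsPositive)
    (hT : IsEigensystem T lam v) (hTpos : T.IsPositive) (j : ℕ) : |mu j - lam j| ≤ ‖S - T‖ :=
  abs_sub_le_iff.2 ⟨by linarith [hS.le_add_norm_sub hT hTpos j],
    by linarith [hT.le_add_norm_sub hS hSpos j, norm_sub_rev S T]⟩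

theorem mul_norm_sub_spanProj_le (hS : IsEigensystem S mu w) (hSpos : S.IsPositive)
    (hT : IsEigensystem T lam v) (hTpos : T.IsPositive) (j K : ℕ) :
    (lam j - mu K) * ‖v j - spanProj w K (v j)‖ ≤ ‖S - T‖ := by
  set x := v j - spanProj w K (v j)
  set y := (T - S) (v j)
  have hx : lam j • x = S x + (y - spanProj w K y) := by
    simp only [x, y, map_sub, hS.apply_spanProj hSpos.isSymmetric, sub_apply, hT.apply_eq,
      map_smul, smul_sub]
    abel
  have hSx : ‖S x‖ ≤ mu K * ‖x‖ :=
    hS.norm_apply_le hSpos fun i hi => inner_sub_spanProj hS.orthonormal hi (v j)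
  have hy : ‖y - spanProj w K y‖ ≤ ‖S - T‖ :=
    calc ‖y - spanProj w K y‖ ≤ ‖y‖ := norm_sub_spanProj_le hS.orthonormal K y
      _ ≤ ‖T - S‖ := (T - S).unit_le_opNorm _ (hT.orthonormal.1 j).le
      _ = ‖S - T‖ := norm_sub_rev T S
  have := norm_add_le_of_le hSx hy
  rw [← hx, norm_smul, Real.norm_of_nonneg (hT.nonneg hTpos j)] at this
  linarith

end IsEigensystem

end Spectral

section Truncation

variable {lam : ℕ → ℝ}

theorem lt_truncationLevel (hanti : Antitone lam) {m : ℝ} {j : ℕ}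
    (hj : j < truncationLevel lam m) : 0 < lam j ∧ (lam j)⁻¹ ≤ m := by
  have hB : j < indexB lam m := hj.trans_le ((min_le_left _ _).trans (min_le_left _ _))
  obtain ⟨_, ⟨i, rfl, hpos, hle⟩, hji⟩ := exists_lt_of_lt_csSup' hB
  have hij := hanti (Nat.lt_succ_iff.1 hji)
  exact ⟨hpos.trans_le hij, (inv_anti₀ hpos hij).trans hle⟩

theorem le_indexB (hlim : Tendsto lam atTop (𝓝 0)) {m : ℝ} (hm : 0 < m) {j : ℕ}
    (hj : m⁻¹ ≤ lam j) : j + 1 ≤ indexB lam m := by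
  obtain ⟨M, hM⟩ := eventually_atTop.1 (hlim.eventually_lt_const (inv_pos.2 hm))
  refine le_csSup ⟨M, ?_⟩ ⟨j, rfl, (inv_pos.2 hm).trans_le hj, inv_le_of_inv_le₀ hm hj⟩
  rintro _ ⟨i, rfl, hi, him⟩
  by_contra! hMi
  exact (hM i (by lia)).not_ge (inv_le_of_inv_le₀ hi him)

theorem le_indexE (hlim : Tendsto lam atTop (𝓝 0)) {m : ℝ} (hm : 0 < m) {N : ℕ} (hN : 1 ≤ N)
    (hgap : ∀ j < N, m⁻¹ ≤ spectralGap lam j) : N ≤ indexE lam m := by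
  have hdiff : Tendsto (fun j => lam j - lam (j + 1)) atTop (𝓝 0) := by
    simpa using hlim.sub (hlim.comp (tendsto_add_atTop_nat 1))
  obtain ⟨M, hM⟩ := eventually_atTop.1 (hdiff.eventually_lt_const (inv_pos.2 hm))
  refine le_csSup ⟨M + 1, ?_⟩ ⟨hN, fun j hj =>
    ⟨(inv_pos.2 hm).trans_le (hgap j hj), inv_le_of_inv_le₀ hm (hgap j hj)⟩⟩
  rintro k ⟨-, hk⟩
  by_contra! hMk
  obtain ⟨hpos, hle⟩ := hk (M + 1) hMk
  exact (hM M le_rfl).not_ge ((inv_le_of_inv_le₀ hpos hle).trans (min_le_left _ _))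

theorem le_truncationLevel (hlim : Tendsto lam atTop (𝓝 0)) {m : ℝ} (hm : 0 < m) {N : ℕ}
    (hN : (N : ℝ) ≤ m) (hlam : ∀ j < N, m⁻¹ ≤ lam j) (hgap : ∀ j < N, m⁻¹ ≤ spectralGap lam j) :
    N ≤ truncationLevel lam m := by
  rcases N with _ | N
  · exact Nat.zero_le _
  · exact le_min (le_min (le_indexB hlim hm (hlam N N.lt_succ_self))
      (le_indexE hlim hm N.succ_pos hgap)) (Nat.le_floor hN)

theorem spectralGap_pos (h : StrictAnti lam) (j : ℕ) : 0 < spectralGap lam j := by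
  cases j with
  | zero => exact sub_pos.2 (h zero_lt_one)
  | succ j => exact lt_min (sub_pos.2 (h j.lt_succ_self)) (sub_pos.2 (h (j + 1).lt_succ_self))

theorem tendsto_spectralGap {ι : Type*} {l : Filter ι} {mu : ι → ℕ → ℝ}
    (h : ∀ j, Tendsto (mu · j) l (𝓝 (lam j))) (j : ℕ) :
    Tendsto (fun i => spectralGap (mu i) j) l (𝓝 (spectralGap lam j)) := by
  cases j with
  | zero => exact (h 0).sub (h 1)
  | succ j => exact ((h j).sub (h (j + 1))).min ((h (j + 1)).sub (h (j + 2)))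

end Truncation

section Estimator

variable {H : Type u} [NormedAddCommGroup H] [InnerProductSpace ℝ H] {lam : ℕ → ℝ} {v : ℕ → H}

theorem pcEstimator_add (D R : H →L[ℝ] H) (lam : ℕ → ℝ) (v : ℕ → H) (K : ℕ) :
    pcEstimator (D + R) lam v K = pcEstimator D lam v K + pcEstimator R lam v K := by
  ext x
  simp [pcEstimator, tensor_apply, ← Finset.sum_add_distrib]

theorem pcEstimator_comp (A D : H →L[ℝ] H) (lam : ℕ → ℝ) (v : ℕ → H) (K : ℕ) :
    pcEstimator (A ∘L D) lam v K = A ∘L pcEstimator D lam v K := by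
  ext x
  simp [pcEstimator, tensor_apply]

theorem IsEigensystem.pcEstimator_self {T : H →L[ℝ] H} (h : IsEigensystem T lam v) {K : ℕ}
    (hK : ∀ j < K, lam j ≠ 0) : pcEstimator T lam v K = spanProj v K :=
  Finset.sum_congr rfl fun j hj => by
    rw [h.apply_eq, inv_smul_smul₀ (hK j (Finset.mem_range.1 hj))]

theorem norm_pcEstimator_id_le (hv : Orthonormal ℝ v) {K : ℕ} {m : ℝ} (hm : 0 ≤ m)
    (hK : ∀ j < K, |(lam j)⁻¹| ≤ m) : ‖pcEstimator (.id ℝ H) lam v K‖ ≤ m := by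
  refine ContinuousLinearMap.opNorm_le_bound _ hm fun x => ?_
  have hx : pcEstimator (.id ℝ H) lam v K x =
      ∑ j ∈ Finset.range K, ((inner ℝ (v j) x : ℝ) * (lam j)⁻¹) • v j := by
    simp [pcEstimator, tensor_apply, smul_smul]
  refine le_of_sq_le_sq ?_ (by positivity)
  rw [← real_inner_self_eq_norm_sq, hx, hv.inner_sum]
  calc ∑ j ∈ Finset.range K, (inner ℝ (v j) x * (lam j)⁻¹) * (inner ℝ (v j) x * (lam j)⁻¹)
      ≤ ∑ j ∈ Finset.range K, m ^ 2 * ‖(inner ℝ (v j) x : ℝ)‖ ^ 2 := by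
        refine Finset.sum_le_sum fun j hj => ?_
        rw [← sq, mul_pow, Real.norm_eq_abs, sq_abs, mul_comm]
        exact mul_le_mul_of_nonneg_right (sq_le_sq' (abs_le.1 (hK j (Finset.mem_range.1 hj))).1
          (abs_le.1 (hK j (Finset.mem_range.1 hj))).2) (sq_nonneg _)
    _ ≤ (m * ‖x‖) ^ 2 := by
        rw [← Finset.mul_sum, mul_pow]
        gcongr
        exact hv.sum_inner_products_le x

theorem IsEigensystem.norm_pcEstimator_sub_le {T : H →L[ℝ] H} (h : IsEigensystem T lam v)
    (Ψ D : H →L[ℝ] H) {m : ℝ} (hm : 0 ≤ m) :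
    ‖pcEstimator D lam v (truncationLevel lam m) - Ψ‖ ≤
      ‖Ψ - Ψ ∘L spanProj v (truncationLevel lam m)‖ + m * ‖D - Ψ ∘L T‖ := by
  set K := truncationLevel lam m
  have hK : ∀ j < K, 0 < lam j ∧ (lam j)⁻¹ ≤ m := fun j hj => lt_truncationLevel h.antitone hj
  have hD : D = Ψ ∘L T + (D - Ψ ∘L T) ∘L .id ℝ H := by simp
  have hnoise : ‖pcEstimator (.id ℝ H) lam v K‖ ≤ m :=
    norm_pcEstimator_id_le h.orthonormal hm fun j hj =>
      (abs_of_pos (inv_pos.2 (hK j hj).1)).trans_le (hK j hj).2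
  calc ‖pcEstimator D lam v K - Ψ‖
      = ‖(Ψ ∘L spanProj v K - Ψ) + (D - Ψ ∘L T) ∘L pcEstimator (.id ℝ H) lam v K‖ := by
        nth_rw 1 [hD]
        rw [pcEstimator_add, pcEstimator_comp, pcEstimator_comp,
          h.pcEstimator_self fun j hj => (hK j hj).1.ne', add_sub_right_comm]
    _ ≤ ‖Ψ ∘L spanProj v K - Ψ‖ + ‖D - Ψ ∘L T‖ * m :=
        norm_add_le_of_le le_rfl ((ContinuousLinearMap.opNorm_comp_le _ _).trans (by gcongr))
    _ = _ := by rw [norm_sub_rev, mul_comm]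

theorem IsEigensystem.exists_hilbertBasis_coe_eq [CompleteSpace H] {C : H →L[ℝ] H}
    (hC : IsEigensystem C lam v) (hrank : DenseRange C) : ∃ b : HilbertBasis ℕ ℝ H, ⇑b = v := by
  refine ⟨HilbertBasis.mk hC.orthonormal ?_, HilbertBasis.coe_mk _ _⟩
  have hrange : (C : H →ₗ[ℝ] H).range.topologicalClosure = ⊤ :=
    (Submodule.dense_iff_topologicalClosure_eq_top).1 hrank
  rw [← hrange, ← hC.closure_span]
  refine Submodule.topologicalClosure_mono (Submodule.span_mono ?_)
  rintro x ⟨j, -, rfl⟩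
  exact ⟨j, rfl⟩

end Estimator

section Consistency

variable {H : Type u} [NormedAddCommGroup H] [InnerProductSpace ℝ H] [CompleteSpace H]
  {C : H →L[ℝ] H} {lam : ℕ → ℝ} {v : ℕ → H} {ι : Type*} {l : Filter ι}
  {T D : ι → H →L[ℝ] H} {mu : ι → ℕ → ℝ} {w : ι → ℕ → H} {m : ι → ℝ}

theorem tendsto_eigenvalue (hC : IsEigensystem C lam v) (hCpos : C.IsPositive)
    (hT : ∀ i, IsEigensystem (T i) (mu i) (w i)) (hTpos : ∀ i, (T i).IsPositive)
    (hTC : Tendsto T l (𝓝 C)) (j : ℕ) : Tendsto (mu · j) l (𝓝 (lam j)) :=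
  tendsto_iff_norm_sub_tendsto_zero.2 (squeeze_zero (fun _ => norm_nonneg _)
    (fun i => (hT i).abs_sub_le_norm_sub (hTpos i) hC hCpos j)
    (tendsto_iff_norm_sub_tendsto_zero.1 hTC))

theorem eventually_le_truncationLevel (hC : IsEigensystem C lam v) (hCpos : C.IsPositive)
    (hlam : StrictAnti lam)
    (hT : ∀ i, IsEigensystem (T i) (mu i) (w i)) (hTpos : ∀ i, (T i).IsPositive)
    (hmu : ∀ i, Tendsto (mu i) atTop (𝓝 0)) (hTC : Tendsto T l (𝓝 C)) (hm : Tendsto m l atTop)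
    (N : ℕ) : ∀ᶠ i in l, N ≤ truncationLevel (mu i) (m i) := by
  have heig := tendsto_eigenvalue hC hCpos hT hTpos hTC
  have hinv : Tendsto (fun i => (m i)⁻¹) l (𝓝 0) := tendsto_inv_atTop_zero.comp hm
  have hle : ∀ᶠ i in l, ∀ j ∈ Finset.range N,
      (m i)⁻¹ ≤ mu i j ∧ (m i)⁻¹ ≤ spectralGap (mu i) j := by
    refine (Finset.eventually_all _).2 fun j _ => ?_
    have hpos : 0 < lam j := (hC.nonneg hCpos (j + 1)).trans_lt (hlam j.lt_succ_self)
    filter_upwards [hinv.eventually_lt (heig j) hpos,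
      hinv.eventually_lt (tendsto_spectralGap heig j) (spectralGap_pos hlam j)] with i hi hi'
    exact ⟨hi.le, hi'.le⟩
  filter_upwards [hle, hm.eventually_gt_atTop 0, hm.eventually_ge_atTop N] with i hi h0 hN
  exact le_truncationLevel (hmu i) h0 hN (fun j hj => (hi j (Finset.mem_range.2 hj)).1)
    fun j hj => (hi j (Finset.mem_range.2 hj)).2

theorem tendsto_norm_sub_spanProj (hC : IsEigensystem C lam v) (hCpos : C.IsPositive)
    (hlam : StrictAnti lam)
    (hT : ∀ i, IsEigensystem (T i) (mu i) (w i)) (hTpos : ∀ i, (T i).IsPositive)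
    (hTC : Tendsto T l (𝓝 C)) {K : ι → ℕ} (hK : ∀ N, ∀ᶠ i in l, N ≤ K i) (j : ℕ) :
    Tendsto (fun i => ‖v j - spanProj (w i) (K i) (v j)‖) l (𝓝 0) := by
  have hgap := (tendsto_eigenvalue hC hCpos hT hTpos hTC (j + 1)).const_sub (lam j)
  have hgap_pos : 0 < lam j - lam (j + 1) := sub_pos.2 (hlam j.lt_succ_self)
  have hbound : Tendsto (fun i => ‖T i - C‖ / (lam j - mu i (j + 1))) l (𝓝 0) :=
    zero_div (lam j - lam (j + 1)) ▸
      (tendsto_iff_norm_sub_tendsto_zero.1 hTC).div hgap hgap_pos.ne'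
  refine squeeze_zero' (.of_forall fun _ => norm_nonneg _) ?_ hbound
  filter_upwards [hK (j + 1), hgap.eventually_const_lt hgap_pos] with i hi hpos
  rw [le_div_iff₀' hpos]
  refine le_trans ?_ ((hT i).mul_norm_sub_spanProj_le (hTpos i) hC hCpos j (K i))
  gcongr
  exact (hT i).antitone hi

theorem tendsto_comp_spanProj_of_tendsto (hC : IsEigensystem C lam v) (hCpos : C.IsPositive)
    (hrank : DenseRange C) (hlam : StrictAnti lam) {Ψ : H →L[ℝ] H}
    (hΨ : hilbertSchmidtNorm Ψ < ∞)
    (hT : ∀ i, IsEigensystem (T i) (mu i) (w i)) (hTpos : ∀ i, (T i).IsPositive)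
    (hTC : Tendsto T l (𝓝 C)) {K : ι → ℕ} (hK : ∀ N, ∀ᶠ i in l, N ≤ K i) :
    Tendsto (fun i => ‖Ψ - Ψ ∘L spanProj (w i) (K i)‖) l (𝓝 0) := by
  obtain ⟨b, rfl⟩ := hC.exists_hilbertBasis_coe_eq hrank
  have hbias : Tendsto (fun N => ‖Ψ - Ψ ∘L spanProj b N‖) atTop (𝓝 0) := by
    simpa only [norm_sub_rev Ψ] using
      tendsto_iff_norm_sub_tendsto_zero.1 (tendsto_comp_spanProj b hΨ)
  refine tendsto_order.2 ⟨fun c hc => .of_forall fun _ => hc.trans_le (norm_nonneg _),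
    fun η hη => ?_⟩
  obtain ⟨N, hN⟩ := (hbias.eventually_lt_const hη).exists
  have hproj : Tendsto (fun i => ‖Ψ - Ψ ∘L spanProj b N‖ +
      ‖Ψ‖ * ∑ j ∈ Finset.range N, ‖b j - spanProj (w i) (K i) (b j)‖) l
      (𝓝 ‖Ψ - Ψ ∘L spanProj b N‖) := by
    simpa using ((tendsto_finsetSum (Finset.range N) fun j _ =>
      tendsto_norm_sub_spanProj hC hCpos hlam hT hTpos hTC hK j).const_mul ‖Ψ‖).const_add
        ‖Ψ - Ψ ∘L spanProj b N‖
  filter_upwards [hproj.eventually_lt_const hN] with i hi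
  exact (norm_sub_comp_spanProj_le Ψ hC.orthonormal (hT i).orthonormal N (K i)).trans_lt hi

theorem tendsto_pcEstimator (hC : IsEigensystem C lam v) (hCpos : C.IsPositive)
    (hrank : DenseRange C) (hlam : StrictAnti lam) {Ψ : H →L[ℝ] H}
    (hΨ : hilbertSchmidtNorm Ψ < ∞)
    (hT : ∀ i, IsEigensystem (T i) (mu i) (w i)) (hTpos : ∀ i, (T i).IsPositive)
    (hmu : ∀ i, Tendsto (mu i) atTop (𝓝 0)) (hTC : Tendsto T l (𝓝 C)) (hm : Tendsto m l atTop)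
    (hD : Tendsto (fun i => m i * ‖D i - Ψ ∘L T i‖) l (𝓝 0)) :
    Tendsto (fun i => pcEstimator (D i) (mu i) (w i) (truncationLevel (mu i) (m i))) l (𝓝 Ψ) := by
  have hbias := tendsto_comp_spanProj_of_tendsto hC hCpos hrank hlam hΨ hT hTpos hTC
    (eventually_le_truncationLevel hC hCpos hlam hT hTpos hmu hTC hm)
  refine tendsto_iff_norm_sub_tendsto_zero.2 (squeeze_zero' (.of_forall fun _ => norm_nonneg _) ?_
    (add_zero (0 : ℝ) ▸ hbias.add hD))
  filter_upwards [hm.eventually_ge_atTop 0] with i hi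
  exact (hT i).norm_pcEstimator_sub_le Ψ (D i) hi

end Consistency

section ConvergenceInMeasure

variable {Ω : Type*} [MeasurableSpace Ω] {ι : Type*} {l : Filter ι} {P : Measure Ω}

/-- The filter of convergence in measure: a set of pairs `(i, ω)` is large if its sections miss
only sets of measure tending to `0` along `l`. Deterministic limit theorems along arbitrary filters
then apply verbatim to convergence in measure. -/
def inMeasure (P : Measure Ω) (l : Filter ι) : Filter (ι × Ω) where
  sets := {A | Tendsto (fun i => P {ω | (i, ω) ∉ A}) l (𝓝 0)}
  univ_sets := by simp [tendsto_const_nhds]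
  sets_of_superset hA hAB := tendsto_of_tendsto_of_tendsto_of_le_of_le tendsto_const_nhds hA
    (fun _ => zero_le) fun _ => measure_mono fun _ hω hA => hω (hAB hA)
  inter_sets {A B} hA hB := by
    refine tendsto_of_tendsto_of_tendsto_of_le_of_le tendsto_const_nhds
      (add_zero (0 : ℝ≥0∞) ▸ Tendsto.add hA hB) (fun _ => zero_le) fun i => ?_
    refine (measure_mono fun ω (hω : (i, ω) ∉ A ∩ B) => ?_).trans (measure_union_le _ _)
    exact not_and_or.1 hω

theorem tendsto_fst_inMeasure : Tendsto Prod.fst (inMeasure P l) l := fun A hA =>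
  tendsto_const_nhds.congr' <| by
    filter_upwards [hA] with i hi
    simp [hi]

theorem tendstoInMeasure_const_iff {E : Type*} [PseudoEMetricSpace E] {f : ι → Ω → E} {c : E} :
    TendstoInMeasure P f l (fun _ => c) ↔
      Tendsto (fun p : ι × Ω => f p.1 p.2) (inMeasure P l) (𝓝 c) := by
  refine Iff.trans (forall₂_congr fun r _ => ?_) EMetric.tendsto_nhds.symm
  simp only [← not_lt]
  rfl

end ConvergenceInMeasure

section Empirical

variable {H : Type u} [NormedAddCommGroup H] [InnerProductSpace ℝ H] {Ω : Type v}
  (X : ℕ → Ω → H) (n : ℕ) (ω : Ω)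

theorem empiricalCross_isPositive [CompleteSpace H] : (empiricalCross X X n ω).IsPositive :=
  (ContinuousLinearMap.isPositive_sum _ fun _ _ =>
    InnerProductSpace.isPositive_rankOne_self _).smul_of_nonneg (by positivity)

theorem empiricalCross_succ_sub_comp (Ψ : H →L[ℝ] H) :
    empiricalCross X (fun k => X (k + 1)) n ω - Ψ ∘L empiricalCross X X n ω =
      empiricalCross X (fun k ω => X (k + 1) ω - Ψ (X k ω)) n ω := by
  ext z
  simp [empiricalCross, tensor_apply, smul_sub, Finset.sum_sub_distrib]

variable {X n ω}

theorem tendsto_eigenvalue_empiricalCross {mu : ℕ → ℝ} {w : ℕ → H}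
    (h : IsEigensystem (empiricalCross X X n ω) mu w) : Tendsto mu atTop (𝓝 0) := by
  have hw : ∀ x : H, Tendsto (fun j => (inner ℝ x (w j) : ℝ)) atTop (𝓝 0) := fun x =>
    tendsto_zero_iff_norm_tendsto_zero.2 <| by
      simpa [real_inner_comm, Real.sqrt_sq_eq_abs] using
        (h.orthonormal.inner_products_summable x).tendsto_atTop_zero.sqrt
  have happly : Tendsto (fun j => ‖empiricalCross X X n ω (w j)‖) atTop (𝓝 0) := by
    simpa [empiricalCross, tensor_apply] using ((tendsto_finsetSum (Finset.Icc 1 n) fun k _ =>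
      (hw (X k ω)).smul_const (X k ω)).const_smul (n : ℝ)⁻¹).norm
  refine tendsto_zero_iff_norm_tendsto_zero.2 (happly.congr fun j => ?_)
  rw [h.apply_eq, norm_smul, h.orthonormal.1 j, mul_one]

end Empirical

theorem toLp_finsetSum {E α ι : Type*} [NormedAddCommGroup E] [MeasurableSpace α] {ν : Measure α}
    {p : ℝ≥0∞} {F : ι → α → E} (hF : ∀ n, MemLp (F n) p ν) (s : Finset ι) :
    (memLp_finsetSum' s fun n _ => hF n).toLp = ∑ n ∈ s, (hF n).toLp := by
  classical
  refine Lp.ext ((MemLp.coeFn_toLp _).trans ?_)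
  refine EventuallyEq.trans ?_ (Lp.coeFn_finsetSum s fun n => (hF n).toLp).symm
  exact eventuallyEq_sum fun n _ => (hF n).coeFn_toLp.symm

section AlmostReflected

variable {K : Type*} [NormedAddCommGroup K] [InnerProductSpace ℝ K]

theorem abs_inner_le_of_map_eq_neg (U : K →ₗᵢ[ℝ] K) {x : K} (hx : U x = -x) (y : K) :
    |(inner ℝ x y : ℝ)| ≤ ‖x‖ * ‖y - U y‖ / 2 := by
  have h : (inner ℝ x (y - U y) : ℝ) = 2 * inner ℝ x y := by
    have hxy := U.inner_map_map x y
    rw [hx, inner_neg_left] at hxy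
    rw [inner_sub_right]
    linarith
  have := abs_real_inner_le_norm x (y - U y)
  rw [h, abs_mul, abs_two] at this
  linarith

theorem norm_sum_sq_le_of_map_eq_neg {U : ℤ → K →ₗᵢ[ℝ] K} {D : ℤ → K}
    (hD : ∀ n, U n (D n) = -D n) {M : ℝ} (hM : ∀ n, ‖D n‖ ≤ M) {γ : ℕ → ℝ} (hγ : Summable γ)
    (hUD : ∀ n (d : ℕ), ‖D (n + d) - U n (D (n + d))‖ ≤ γ d) (s : Finset ℤ) :
    ‖∑ n ∈ s, D n‖ ^ 2 ≤ s.card * (M / 2 * ∑' j : ℤ, γ j.natAbs) := by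
  have hM0 : 0 ≤ M := (norm_nonneg _).trans (hM 0)
  have hγ0 : ∀ d, 0 ≤ γ d := fun d => (norm_nonneg _).trans (hUD 0 d)
  have hsum : Summable fun j : ℤ => γ j.natAbs := .of_nat_of_neg (by simpa) (by simpa)
  have hinner_add : ∀ n (d : ℕ), (inner ℝ (D n) (D (n + d)) : ℝ) ≤ M / 2 * γ d := fun n d =>
    calc (inner ℝ (D n) (D (n + d)) : ℝ) ≤ ‖D n‖ * ‖D (n + d) - U n (D (n + d))‖ / 2 :=
          (le_abs_self _).trans (abs_inner_le_of_map_eq_neg (U n) (hD n) _)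
      _ ≤ M * γ d / 2 := by gcongr; exacts [hM n, hUD n d]
      _ = M / 2 * γ d := by ring
  have hinner : ∀ k l, (inner ℝ (D k) (D l) : ℝ) ≤ M / 2 * γ (l - k).natAbs := fun k l => by
    rcases le_total k l with h | h
    · have := hinner_add k (l - k).natAbs
      rwa [show k + ((l - k).natAbs : ℤ) = l by omega] at this
    · have := hinner_add l (l - k).natAbs
      rwa [show l + ((l - k).natAbs : ℤ) = k by omega, real_inner_comm] at this
  calc ‖∑ n ∈ s, D n‖ ^ 2 = ∑ k ∈ s, ∑ l ∈ s, (inner ℝ (D k) (D l) : ℝ) := by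
        rw [← real_inner_self_eq_norm_sq, sum_inner]
        simp only [inner_sum]
    _ ≤ ∑ k ∈ s, M / 2 * ∑ l ∈ s, γ (l - k).natAbs := by
        simp only [Finset.mul_sum]
        exact Finset.sum_le_sum fun k _ => Finset.sum_le_sum fun l _ => hinner k l
    _ ≤ ∑ k ∈ s, M / 2 * ∑' j : ℤ, γ j.natAbs := by
        gcongr with k
        rw [← (Equiv.subRight k).tsum_eq fun j : ℤ => γ j.natAbs]
        exact ((Equiv.subRight k).summable_iff.2 hsum).sum_le_tsum s fun _ _ => hγ0 _
    _ = s.card * (M / 2 * ∑' j : ℤ, γ j.natAbs) := by rw [Finset.sum_const, nsmul_eq_mul]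

variable {α : Type*} [MeasurableSpace α] {ν : Measure α} {F : ℤ → α → K} {σ : ℤ → α → α}

/-- The isometries `F ↦ F ∘ σ n` reflect `F n` and hardly move the much later `F (n + d)`, which
makes the family almost orthogonal. -/
theorem exists_eLpNorm_sum_le_of_comp_eq_neg (hσ : ∀ n, MeasurePreserving (σ n) ν ν)
    (hF : ∀ n, MemLp (F n) 2 ν) (hneg : ∀ n, F n ∘ σ n = -F n) {M : ℝ≥0∞} (hM : M ≠ ∞)
    (hFM : ∀ n, eLpNorm (F n) 2 ν ≤ M) {γ : ℕ → ℝ≥0∞} (hγ : ∑' d, γ d ≠ ∞)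
    (hFσ : ∀ n (d : ℕ), eLpNorm (F (n + d) - F (n + d) ∘ σ n) 2 ν ≤ γ d) :
    ∃ c : ℝ, ∀ s : Finset ℤ, eLpNorm (∑ n ∈ s, F n) 2 ν ≤ ENNReal.ofReal (c * √s.card) := by
  have hcomp := fun n k => (hF k).comp_measurePreserving (hσ n)
  have hvar := norm_sum_sq_le_of_map_eq_neg (D := fun n => (hF n).toLp)
    (U := fun n => Lp.compMeasurePreservingₗᵢ ℝ (σ n) (hσ n)) (M := M.toReal)
    (γ := fun d => (γ d).toReal)
    (fun n => show (hcomp n n).toLp = _ by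
      rw [← MemLp.toLp_neg, MemLp.toLp_eq_toLp_iff, hneg])
    (fun n => by
      rw [Lp.norm_toLp]
      exact ENNReal.toReal_mono hM (hFM n))
    (ENNReal.summable_toReal hγ)
    (fun n d => by
      change ‖(hF (n + d)).toLp - (hcomp n (n + d)).toLp‖ ≤ _
      rw [← MemLp.toLp_sub, Lp.norm_toLp]
      exact ENNReal.toReal_mono (ENNReal.ne_top_of_tsum_ne_top hγ d) (hFσ n d))
  refine ⟨√(M.toReal / 2 * ∑' j : ℤ, (γ j.natAbs).toReal), fun s => ?_⟩
  have hs := hvar s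
  have hsum := memLp_finsetSum' s fun n _ => hF n
  rw [← toLp_finsetSum hF, Lp.norm_toLp, mul_comm] at hs
  rw [← ENNReal.ofReal_toReal hsum.eLpNorm_ne_top, ← Real.sqrt_mul (by positivity)]
  exact ENNReal.ofReal_le_ofReal (Real.le_sqrt_of_sq_le hs)

end AlmostReflected

section IID

variable {S : Type*} [MeasurableSpace S]

/-- The law on `ι → S` of a family of independent variables with common law `μ`. -/
noncomputable abbrev iid (ι : Type*) (μ : Measure S) : Measure (ι → S) :=
  Measure.infinitePi fun _ => μ

theorem measurePreserving_comp_of_injective (μ : Measure S) [IsProbabilityMeasure μ]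
    {ι κ : Type*} {e : ι → κ} (he : e.Injective) :
    MeasurePreserving (fun x : κ → S => x ∘ e) (iid κ μ) (iid ι μ) :=
  ⟨measurable_pi_lambda _ fun i => measurable_pi_apply (e i),
    Measure.map_infinitePi_infinitePi_of_inj he⟩

end IID

section Approximable

variable {S : Type*} {G : Type*} [NormedAddCommGroup G]

/-- The positions of `(x_0, …, x_{d-1}, x'_d, x'_{d+1}, …)` in a pair `(x, x')` of sequences that is
encoded as a function on `Bool × ℕ`, the second sequence being marked by `true`. -/
def splice (d : ℕ) (k : ℕ) : Bool × ℕ := (decide (d ≤ k), k)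

theorem splice_injective (d : ℕ) : (splice d).Injective := fun _ _ h => congrArg Prod.snd h

/-- The effect on `f` of replacing all but the `d` most recent inputs by an independent copy. -/
def couplingDiff (f : (ℕ → S) → G) (d : ℕ) (x : Bool × ℕ → S) : G :=
  f (x ∘ Prod.mk false) - f (x ∘ splice d)

variable [MeasurableSpace S]

/-- The `m`-approximation coefficient `‖Z - Z⁽ᵈ⁾‖_p` of the stationary process
`Z_n = f (δ_n, δ_{n-1}, …)` with innovations of law `μ`. -/
noncomputable def couplingNorm (p : ℝ≥0∞) (μ : Measure S) (f : (ℕ → S) → G) (d : ℕ) : ℝ≥0∞ :=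
  eLpNorm (couplingDiff f d) p (iid (Bool × ℕ) μ)

/-- `L^p`-`m`-approximability in terms of the functional `f` and the law `μ` of the innovations. The
coefficient with index `0` is included; it is finite for any `f` in `L^p`. -/
structure IsMApproximable (p : ℝ≥0∞) (μ : Measure S) (f : (ℕ → S) → G) : Prop where
  memLp : MemLp f p (iid ℕ μ)
  tsum_ne_top : ∑' d, couplingNorm p μ f d ≠ ∞

variable {μ : Measure S} {p q r : ℝ≥0∞}
variable {G' : Type*} [NormedAddCommGroup G'] {f f' : (ℕ → S) → G} {g : (ℕ → S) → G'}

theorem IsMApproximable.continuousLinearMap_comp [NormedSpace ℝ G] [NormedSpace ℝ G']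
    (hf : IsMApproximable p μ f) (L : G →L[ℝ] G') : IsMApproximable p μ fun z => L (f z) where
  memLp := L.comp_memLp' hf.memLp
  tsum_ne_top := by
    refine ne_top_of_le_ne_top (ENNReal.mul_ne_top (enorm_ne_top (x := L)) hf.tsum_ne_top) ?_
    rw [← ENNReal.tsum_mul_left]
    refine ENNReal.tsum_le_tsum fun d => ?_
    refine eLpNorm_le_mul_eLpNorm_of_ae_le_mul' (c := ‖L‖₊) (ae_of_all _ fun x => ?_) p
    rw [couplingDiff, ← map_sub]
    exact L.le_opENorm _

variable [IsProbabilityMeasure μ]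

theorem memLp_couplingDiff (hf : MemLp f p (iid ℕ μ)) (d : ℕ) :
    MemLp (couplingDiff f d) p (iid (Bool × ℕ) μ) :=
  (hf.comp_measurePreserving
    (measurePreserving_comp_of_injective μ (Prod.mk_right_injective false))).sub
    (hf.comp_measurePreserving (measurePreserving_comp_of_injective μ (splice_injective d)))

theorem couplingNorm_ne_top (hf : MemLp f p (iid ℕ μ)) (d : ℕ) : couplingNorm p μ f d ≠ ∞ :=
  (memLp_couplingDiff hf d).eLpNorm_ne_top

theorem couplingNorm_comp_tail (hf : AEStronglyMeasurable f (iid ℕ μ)) (d : ℕ) :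
    couplingNorm p μ (fun z => f (z ∘ Nat.succ)) (d + 1) = couplingNorm p μ f d := by
  have hmeas : AEStronglyMeasurable (couplingDiff f d) (iid (Bool × ℕ) μ) :=
    (memLp_couplingDiff (memLp_zero_iff_aestronglyMeasurable.2 hf) d).1
  have hshift : couplingDiff (fun z => f (z ∘ Nat.succ)) (d + 1) =
      couplingDiff f d ∘ fun x : Bool × ℕ → S => x ∘ Prod.map id Nat.succ := by
    funext x
    simp only [couplingDiff, splice, Function.comp_def, Prod.map_apply, id_eq, Nat.succ_eq_add_one,
      add_le_add_iff_right]
  rw [couplingNorm, hshift]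
  exact eLpNorm_comp_measurePreserving hmeas
    (measurePreserving_comp_of_injective μ (Function.injective_id.prodMap Nat.succ_injective))

namespace IsMApproximable

theorem comp_tail (hf : IsMApproximable p μ f) :
    IsMApproximable p μ fun z => f (z ∘ Nat.succ) where
  memLp := hf.memLp.comp_measurePreserving
    (measurePreserving_comp_of_injective μ Nat.succ_injective)
  tsum_ne_top := by
    rw [tsum_eq_zero_add' ENNReal.summable]
    simp only [couplingNorm_comp_tail hf.memLp.1]
    exact ENNReal.add_ne_top.2 ⟨couplingNorm_ne_top (hf.memLp.comp_measurePreserving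
      (measurePreserving_comp_of_injective μ Nat.succ_injective)) 0, hf.tsum_ne_top⟩

theorem add (hp : 1 ≤ p) (hf : IsMApproximable p μ f) (hf' : IsMApproximable p μ f') :
    IsMApproximable p μ fun z => f z + f' z where
  memLp := hf.memLp.add hf'.memLp
  tsum_ne_top := by
    refine ne_top_of_le_ne_top (ENNReal.add_ne_top.2 ⟨hf.tsum_ne_top, hf'.tsum_ne_top⟩) ?_
    rw [← ENNReal.tsum_add]
    refine ENNReal.tsum_le_tsum fun d => ?_
    have hadd : couplingDiff (fun z => f z + f' z) d = couplingDiff f d + couplingDiff f' d :=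
      funext fun x => add_sub_add_comm _ _ _ _
    rw [couplingNorm, hadd]
    exact eLpNorm_add_le (memLp_couplingDiff hf.memLp d).1 (memLp_couplingDiff hf'.memLp d).1 hp

end IsMApproximable

section Tensor

open scoped TensorProduct

variable [InnerProductSpace ℝ G] [InnerProductSpace ℝ G']

theorem memLp_tmul {α : Type*} [MeasurableSpace α] {P : Measure α} {u : α → G} {v : α → G'}
    [ENNReal.HolderTriple p q r] (hu : MemLp u p P) (hv : MemLp v q P) :
    MemLp (fun x => u x ⊗ₜ[ℝ] v x) r P :=
  MemLp.of_bilin (fun a b => a ⊗ₜ[ℝ] b) 1 hu hv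
    (TensorProduct.continuous_tmul.comp_aestronglyMeasurable (hu.1.prodMk hv.1))
    (ae_of_all _ fun x => by simp)

theorem eLpNorm_tmul_le {α : Type*} [MeasurableSpace α] {P : Measure α} {u : α → G} {v : α → G'}
    [ENNReal.HolderTriple p q r] (hu : AEStronglyMeasurable u P) (hv : AEStronglyMeasurable v P) :
    eLpNorm (fun x => u x ⊗ₜ[ℝ] v x) r P ≤ eLpNorm u p P * eLpNorm v q P := by
  simpa using eLpNorm_le_eLpNorm_mul_eLpNorm_of_nnnorm hu hv (fun a b => a ⊗ₜ[ℝ] b) 1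
    (ae_of_all _ fun x => by simp) (r := r)

theorem couplingNorm_tmul_le [ENNReal.HolderTriple p q r] (hr : 1 ≤ r)
    (hf : MemLp f p (iid ℕ μ)) (hg : MemLp g q (iid ℕ μ)) (d : ℕ) :
    couplingNorm r μ (fun z => f z ⊗ₜ[ℝ] g z) d ≤
      couplingNorm p μ f d * eLpNorm g q (iid ℕ μ) +
        eLpNorm f p (iid ℕ μ) * couplingNorm q μ g d := by
  have hfst := measurePreserving_comp_of_injective μ (Prod.mk_right_injective (β := ℕ) false)
  have hsplice := measurePreserving_comp_of_injective μ (splice_injective d)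
  have hf' := hf.comp_measurePreserving hsplice
  have hg' := hg.comp_measurePreserving hfst
  have hdf := memLp_couplingDiff hf d
  have hdg := memLp_couplingDiff hg d
  have hsplit : couplingDiff (fun z => f z ⊗ₜ[ℝ] g z) d =
      (fun x => couplingDiff f d x ⊗ₜ[ℝ] (g ∘ fun x => x ∘ Prod.mk false) x) +
        fun x => (f ∘ fun x => x ∘ splice d) x ⊗ₜ[ℝ] couplingDiff g d x := by
    funext x
    simp only [couplingDiff, Pi.add_apply, Function.comp_apply, TensorProduct.sub_tmul,
      TensorProduct.tmul_sub, sub_add_sub_cancel]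
  rw [← eLpNorm_comp_measurePreserving hg.1 hfst, ← eLpNorm_comp_measurePreserving hf.1 hsplice,
    couplingNorm, hsplit]
  exact (eLpNorm_add_le (memLp_tmul hdf hg' (r := r)).1 (memLp_tmul hf' hdg (r := r)).1 hr).trans
    (add_le_add (eLpNorm_tmul_le hdf.1 hg'.1) (eLpNorm_tmul_le hf'.1 hdg.1))

theorem IsMApproximable.tmul [ENNReal.HolderTriple p q r] (hr : 1 ≤ r)
    (hf : IsMApproximable p μ f) (hg : IsMApproximable q μ g) :
    IsMApproximable r μ fun z => f z ⊗ₜ[ℝ] g z where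
  memLp := memLp_tmul hf.memLp hg.memLp
  tsum_ne_top := by
    refine ne_top_of_le_ne_top ?_
      (ENNReal.tsum_le_tsum (couplingNorm_tmul_le hr hf.memLp hg.memLp))
    rw [ENNReal.tsum_add, ENNReal.tsum_mul_left, ENNReal.tsum_mul_right]
    exact ENNReal.add_ne_top.2 ⟨ENNReal.mul_ne_top hf.tsum_ne_top hg.memLp.eLpNorm_ne_top,
      ENNReal.mul_ne_top hf.memLp.eLpNorm_ne_top hg.tsum_ne_top⟩

end Tensor

end Approximable

section TwoCopies

variable {S : Type*} {G : Type*} [NormedAddCommGroup G]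

/-- The positions of the innovations `δ_n, δ_{n-1}, …` of the copy `b` in a pair of two-sided
sequences that is encoded as a function on `Bool × ℤ`. -/
def past (b : Bool) (n : ℤ) (k : ℕ) : Bool × ℤ := (b, n - k)

/-- The exchange of the two copies at all times up to `n`. -/
def swapUpTo (n : ℤ) (i : Bool × ℤ) : Bool × ℤ := if i.2 ≤ n then (!i.1, i.2) else i

/-- The difference at time `n` of the stationary process `f (δ_n, δ_{n-1}, …)` and its copy. -/
def copyDiff (f : (ℕ → S) → G) (n : ℤ) (x : Bool × ℤ → S) : G :=
  f (x ∘ past false n) - f (x ∘ past true n)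

theorem past_injective (b : Bool) (n : ℤ) : (past b n).Injective := fun k l h => by
  simpa [past] using h

theorem swapUpTo_injective (n : ℤ) : (swapUpTo n).Injective :=
  Function.Involutive.injective fun i => by
    by_cases h : i.2 ≤ n <;> simp [swapUpTo, h]

theorem copyDiff_comp_swapUpTo (f : (ℕ → S) → G) (n : ℤ) (x : Bool × ℤ → S) :
    copyDiff f n (x ∘ swapUpTo n) = -copyDiff f n x := by
  have h : ∀ b, swapUpTo n ∘ past b n = past (!b) n := fun b => by
    funext k
    simp [swapUpTo, past]
  simp only [copyDiff, Function.comp_assoc, h, Bool.not_false, Bool.not_true, neg_sub]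

theorem copyDiff_sub_comp_swapUpTo (f : (ℕ → S) → G) (n : ℤ) (d : ℕ) (x : Bool × ℤ → S) :
    copyDiff f (n + d) x - copyDiff f (n + d) (x ∘ swapUpTo n) =
      couplingDiff f d (x ∘ fun i => past i.1 (n + d) i.2) -
        couplingDiff f d (x ∘ fun i => past (!i.1) (n + d) i.2) := by
  have hfalse : swapUpTo n ∘ past false (n + d) =
      (fun i => past i.1 (n + d) i.2) ∘ splice d := by
    funext k
    by_cases h : d ≤ k <;> simp [swapUpTo, past, splice, h]
  have htrue : swapUpTo n ∘ past true (n + d) =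
      (fun i => past (!i.1) (n + d) i.2) ∘ splice d := by
    funext k
    by_cases h : d ≤ k <;> simp [swapUpTo, past, splice, h]
  simp only [copyDiff, couplingDiff, Function.comp_assoc, hfalse, htrue]
  exact sub_sub_sub_comm _ _ _ _

variable [MeasurableSpace S] {μ : Measure S} [IsProbabilityMeasure μ] {p : ℝ≥0∞}
  {f : (ℕ → S) → G}

theorem memLp_copyDiff (hf : MemLp f p (iid ℕ μ)) (n : ℤ) :
    MemLp (copyDiff f n) p (iid (Bool × ℤ) μ) :=
  (hf.comp_measurePreserving (measurePreserving_comp_of_injective μ (past_injective false n))).sub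
    (hf.comp_measurePreserving (measurePreserving_comp_of_injective μ (past_injective true n)))

theorem eLpNorm_copyDiff_le (hp : 1 ≤ p) (hf : MemLp f p (iid ℕ μ)) (n : ℤ) :
    eLpNorm (copyDiff f n) p (iid (Bool × ℤ) μ) ≤ 2 * eLpNorm f p (iid ℕ μ) := by
  have hpast := fun b => measurePreserving_comp_of_injective μ (past_injective b n)
  refine (eLpNorm_sub_le (hf.comp_measurePreserving (hpast false)).1
    (hf.comp_measurePreserving (hpast true)).1 hp).trans_eq ?_
  rw [eLpNorm_comp_measurePreserving hf.1 (hpast false),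
    eLpNorm_comp_measurePreserving hf.1 (hpast true), two_mul]

theorem eLpNorm_copyDiff_sub_comp_swapUpTo_le (hp : 1 ≤ p) (hf : MemLp f p (iid ℕ μ)) (n : ℤ)
    (d : ℕ) :
    eLpNorm (copyDiff f (n + d) - fun x => copyDiff f (n + d) (x ∘ swapUpTo n)) p
      (iid (Bool × ℤ) μ) ≤ 2 * couplingNorm p μ f d := by
  have hd := memLp_couplingDiff hf d
  have hfalse := measurePreserving_comp_of_injective μ
    (e := fun i : Bool × ℕ => past i.1 (n + d) i.2) fun i j h => by
      simpa [past, Prod.ext_iff] using h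
  have htrue := measurePreserving_comp_of_injective μ
    (e := fun i : Bool × ℕ => past (!i.1) (n + d) i.2) fun i j h => by
      simpa [past, Prod.ext_iff] using h
  rw [show (copyDiff f (n + d) - fun x => copyDiff f (n + d) (x ∘ swapUpTo n)) = _ from
    funext (copyDiff_sub_comp_swapUpTo f n d)]
  refine (eLpNorm_sub_le (hd.comp_measurePreserving hfalse).1
    (hd.comp_measurePreserving htrue).1 hp).trans_eq ?_
  rw [eLpNorm_comp_measurePreserving hd.1 hfalse, eLpNorm_comp_measurePreserving hd.1 htrue,
    ← two_mul, couplingNorm]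

/-- The swap of the copies up to time `n` preserves the law, negates the difference at time `n`, and
hardly affects the difference at a much later time. -/
theorem IsMApproximable.exists_eLpNorm_sum_copyDiff_le [InnerProductSpace ℝ G]
    (hf : IsMApproximable 2 μ f) :
    ∃ c : ℝ, ∀ s : Finset ℤ, eLpNorm (∑ n ∈ s, copyDiff f n) 2 (iid (Bool × ℤ) μ) ≤
      ENNReal.ofReal (c * √s.card) := by
  refine exists_eLpNorm_sum_le_of_comp_eq_neg
    (fun n => measurePreserving_comp_of_injective μ (swapUpTo_injective n))
    (memLp_copyDiff hf.memLp) (fun n => funext (copyDiff_comp_swapUpTo f n))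
    (ENNReal.mul_ne_top ENNReal.ofNat_ne_top hf.memLp.eLpNorm_ne_top)
    (eLpNorm_copyDiff_le one_le_two hf.memLp) ?_
    (eLpNorm_copyDiff_sub_comp_swapUpTo_le one_le_two hf.memLp)
  rw [ENNReal.tsum_mul_left]
  exact ENNReal.mul_ne_top ENNReal.ofNat_ne_top hf.tsum_ne_top

end TwoCopies

section Sampling

variable {Ω S ι : Type*}

/-- The pair of paths obtained by evaluating a process at two sample points, encoded as a function
on `Bool × ι`. -/
def pairPath (x : Ω → ι → S) (z : Ω × Ω) (i : Bool × ι) : S := (bif i.1 then x z.2 else x z.1) i.2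

variable [MeasurableSpace Ω] [MeasurableSpace S] {P : Measure Ω} {μ : Measure S}
  [IsProbabilityMeasure μ]

theorem measurePreserving_path {δ : ι → Ω → S} {i₀ : ι} (hδ : ∀ i, Measurable (δ i))
    (hind : iIndepFun δ P) (hident : ∀ i, IdentDistrib (δ i) (δ i₀) P P) :
    MeasurePreserving (fun ω i => δ i ω) P (iid ι (P.map (δ i₀))) := by
  refine ⟨measurable_pi_lambda _ hδ, ?_⟩
  rw [hind.map_fun_eq_infinitePi_map hδ]
  exact congrArg Measure.infinitePi (funext fun i => (hident i).map_eq)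

theorem measurePreserving_comp_sub {x : Ω → ℤ → S} (hx : MeasurePreserving x P (iid ℤ μ)) (n : ℤ) :
    MeasurePreserving (fun ω (k : ℕ) => x ω (n - k)) P (iid ℕ μ) :=
  (measurePreserving_comp_of_injective μ (e := fun k : ℕ => n - k)
    fun k l h => by simpa using h).comp hx

variable [IsProbabilityMeasure P]

theorem measurePreserving_bool_pair :
    MeasurePreserving (fun (z : Ω × Ω) (b : Bool) => bif b then z.2 else z.1) (P.prod P)
      (iid Bool P) := by
  have hmeas : Measurable fun (z : Ω × Ω) (b : Bool) => bif b then z.2 else z.1 :=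
    measurable_pi_lambda _ fun b => by cases b; exacts [measurable_fst, measurable_snd]
  refine ⟨hmeas, ?_⟩
  rw [iid, Measure.infinitePi_eq_pi]
  refine (Measure.pi_eq fun s hs => ?_).symm
  have hpre : (fun (z : Ω × Ω) (b : Bool) => bif b then z.2 else z.1) ⁻¹' Set.univ.pi s =
      s false ×ˢ s true := by
    ext z
    simp
  rw [Measure.map_apply hmeas (.univ_pi hs), hpre, Measure.prod_prod, Fintype.prod_bool, mul_comm]

theorem measurePreserving_pairPath {x : Ω → ι → S} (hx : MeasurePreserving x P (iid ι μ)) :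
    MeasurePreserving (pairPath x) (P.prod P) (iid (Bool × ι) μ) :=
  have hcurry : MeasurePreserving (MeasurableEquiv.curry Bool ι S).symm (iid Bool (iid ι μ))
      (iid (Bool × ι) μ) :=
    ⟨MeasurableEquiv.measurable _, Measure.infinitePi_map_curry_symm fun _ _ => μ⟩
  hcurry.comp (measurePreserving_bool_pair.comp (hx.prod hx))

end Sampling

section BernoulliShift

variable {Ω : Type u} [MeasurableSpace Ω] {P : Measure Ω} [IsProbabilityMeasure P]
  {H : Type v} [NormedAddCommGroup H] {p : ℝ≥0∞} {X : ℕ → Ω → H}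

theorem eLpNorm_sub_coupled {S : Type w} [MeasurableSpace S] {μ : Measure S}
    [IsProbabilityMeasure μ] {δ : ℤ → Ω → S} {f : (ℕ → S) → H}
    (hδ : MeasurePreserving (fun ω i => δ i ω) P (iid ℤ μ)) (hf : MemLp f p (iid ℕ μ)) {n : ℕ}
    (hX : X n =ᵐ[P] fun ω => f fun k : ℕ => δ (n - k) ω) (d : ℕ) :
    eLpNorm (fun z : Ω × Ω => X n z.1 - coupled f δ n d z) p (P.prod P) = couplingNorm p μ f d := by
  have hpair := (measurePreserving_comp_of_injective μ
    (e := fun i : Bool × ℕ => past i.1 n i.2) fun i j h => by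
      simpa [past, Prod.ext_iff] using h).comp (measurePreserving_pairPath hδ)
  rw [couplingNorm, ← eLpNorm_comp_measurePreserving (memLp_couplingDiff hf d).1 hpair]
  refine eLpNorm_congr_ae ?_
  filter_upwards [Measure.quasiMeasurePreserving_fst.ae_eq_comp hX] with z hz
  have hcoupled : coupled f δ n d z =
      f ((pairPath (fun ω i => δ i ω) z ∘ fun i => past i.1 n i.2) ∘ splice d) := by
    refine congrArg f (funext fun k => ?_)
    by_cases h : k < d
    · simp [pairPath, past, splice, h, Nat.not_le.2 h]
    · simp [pairPath, past, splice, h, Nat.le_of_not_lt h]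
  rw [hcoupled]
  exact congrArg (· - _) hz

theorem LpMApproximable.exists_isMApproximable [InnerProductSpace ℝ H] [MeasurableSpace H]
    [OpensMeasurableSpace H] [SecondCountableTopology H] (hX : LpMApproximable.{u, v, w} p X P) :
    ∃ (S : Type w) (_ : MeasurableSpace S) (μ : Measure S) (_ : IsProbabilityMeasure μ)
      (x : Ω → ℤ → S) (f : (ℕ → S) → H), MeasurePreserving x P (iid ℤ μ) ∧
        IsMApproximable p μ f ∧ ∀ n : ℕ, 1 ≤ n → X n =ᵐ[P] fun ω => f fun k : ℕ => x ω (n - k) := by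
  obtain ⟨hmem, S, hS, δ, f, hδ, hind, hident, hf, hXf, hsum⟩ := hX
  have hμ := Measure.isProbabilityMeasure_map (μ := P) (hδ 0).aemeasurable
  have hpath := measurePreserving_path hδ hind hident
  have hfmem : MemLp f p (iid ℕ (P.map (δ 0))) := by
    have hlaw := measurePreserving_comp_sub hpath 1
    have hmem₁ := (memLp_congr_ae (hXf 1 le_rfl)).1 (hmem 1 le_rfl)
    rw [← hlaw.map_eq, memLp_map_measure_iff hf.aestronglyMeasurable hlaw.aemeasurable]
    exact hmem₁
  refine ⟨S, hS, P.map (δ 0), hμ, fun ω i => δ i ω, f, hpath, ⟨hfmem, ?_⟩, hXf⟩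
  rw [tsum_eq_zero_add' ENNReal.summable]
  simp only [eLpNorm_sub_coupled hpath hfmem (hXf _ (Nat.le_add_left 1 _))] at hsum
  exact ENNReal.add_ne_top.2 ⟨couplingNorm_ne_top hfmem 0, hsum.ne⟩

end BernoulliShift

section TensorOperator

open scoped TensorProduct

variable {H₁ : Type u} [NormedAddCommGroup H₁] [InnerProductSpace ℝ H₁]
  {H₂ : Type v} [NormedAddCommGroup H₂] [InnerProductSpace ℝ H₂]

/-- The linear extension of `x ⊗ₜ y ↦ tensor x y` to the algebraic tensor product. -/
noncomputable def tensorOperatorLinear : H₁ ⊗[ℝ] H₂ →ₗ[ℝ] H₁ →L[ℝ] H₂ :=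
  TensorProduct.lift <| LinearMap.mk₂ ℝ tensor
    (fun _ _ _ => by ext; simp [tensor_apply, inner_add_left, add_smul])
    (fun _ _ _ => by ext; simp [tensor_apply, real_inner_smul_left, mul_smul])
    (fun _ _ _ => by ext; simp [tensor_apply])
    (fun _ _ _ => by ext; simp [tensor_apply, smul_smul, mul_comm])

theorem inner_tensorOperatorLinear (t : H₁ ⊗[ℝ] H₂) (x : H₁) (y : H₂) :
    (inner ℝ y (tensorOperatorLinear t x) : ℝ) = inner ℝ (x ⊗ₜ[ℝ] y) t := by
  induction t with
  | zero => simp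
  | tmul a b =>
    simp [tensorOperatorLinear, tensor_apply, real_inner_smul_right, real_inner_comm x a]
  | add s t hs ht => simp only [map_add, add_apply, inner_add_right, hs, ht]

/-- The operator with Hilbert-Schmidt kernel `t`. It is bounded by the Hilbert norm of the tensor
product, so that norm estimates in that inner product space carry over to operators. -/
noncomputable def tensorOperator : H₁ ⊗[ℝ] H₂ →L[ℝ] H₁ →L[ℝ] H₂ :=
  tensorOperatorLinear.mkContinuous 1 fun t => by
    rw [one_mul]
    refine ContinuousLinearMap.opNorm_le_bound _ (norm_nonneg t) fun x => ?_
    set y := tensorOperatorLinear t x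
    rcases eq_or_ne y 0 with hy | hy
    · rw [hy, norm_zero]
      positivity
    refine le_of_mul_le_mul_left ?_ (norm_pos_iff.2 hy)
    calc ‖y‖ * ‖y‖ = inner ℝ (x ⊗ₜ[ℝ] y) t := by
          rw [← inner_tensorOperatorLinear, real_inner_self_eq_norm_mul_norm]
      _ ≤ ‖x ⊗ₜ[ℝ] y‖ * ‖t‖ := real_inner_le_norm (x ⊗ₜ[ℝ] y) t
      _ = ‖y‖ * (‖t‖ * ‖x‖) := by
          rw [TensorProduct.norm_tmul]
          ring

theorem tensorOperator_tmul (x : H₁) (y : H₂) : tensorOperator (x ⊗ₜ[ℝ] y) = tensor x y := by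
  simp [tensorOperator, tensorOperatorLinear]

theorem integrable_tensor {Ω : Type*} [MeasurableSpace Ω] {P : Measure Ω} {U : Ω → H₁} {V : Ω → H₂}
    (hU : MemLp U 2 P) (hV : MemLp V 2 P) : Integrable (fun ω => tensor (U ω) (V ω)) P := by
  simpa only [tensorOperator_tmul] using
    tensorOperator.integrable_comp (memLp_one_iff_integrable.1 (memLp_tmul hU hV))

end TensorOperator

section LawOfLargeNumbers

variable {Ω : Type*} [MeasurableSpace Ω] {P : Measure Ω} [IsProbabilityMeasure P]
  {E : Type*} [NormedAddCommGroup E] [NormedSpace ℝ E] [CompleteSpace E]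

theorem eLpNorm_sub_integral_le {F : Ω → E} (hF : Integrable F P) :
    eLpNorm (fun ω => F ω - ∫ ω', F ω' ∂P) 1 P ≤
      eLpNorm (fun z : Ω × Ω => F z.1 - F z.2) 1 (P.prod P) := by
  have hdiff : AEStronglyMeasurable (fun z : Ω × Ω => F z.1 - F z.2) (P.prod P) :=
    (hF.comp_fst P).1.sub (hF.comp_snd P).1
  simp only [eLpNorm_one_eq_lintegral_enorm]
  rw [lintegral_prod _ hdiff.enorm]
  refine lintegral_mono fun ω => ?_
  have hcenter : F ω - ∫ ω', F ω' ∂P = ∫ ω', (F ω - F ω') ∂P := by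
    rw [integral_sub (integrable_const _) hF, integral_const, probReal_univ, one_smul]
  rw [hcenter]
  exact enorm_integral_le_lintegral_enorm _

variable {S : Type*} [MeasurableSpace S] {μ : Measure S} [IsProbabilityMeasure μ] {x : Ω → ℤ → S}

theorem eLpNorm_sum_sub_integral_le {f : (ℕ → S) → E} (hf : Integrable f (iid ℕ μ))
    (hx : MeasurePreserving x P (iid ℤ μ)) (s : Finset ℤ) :
    eLpNorm (fun ω => ∑ n ∈ s, f (fun k : ℕ => x ω (n - k)) - s.card • ∫ z, f z ∂iid ℕ μ) 1 P ≤
      eLpNorm (∑ n ∈ s, copyDiff f n) 1 (iid (Bool × ℤ) μ) := by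
  have hpast := measurePreserving_comp_sub hx
  have hint : ∀ n : ℤ, Integrable (fun ω => f fun k : ℕ => x ω (n - k)) P := fun n =>
    (hpast n).integrable_comp_of_integrable hf
  have hmean : ∀ n : ℤ, ∫ ω, f (fun k : ℕ => x ω (n - k)) ∂P = ∫ z, f z ∂iid ℕ μ := fun n => by
    rw [← (hpast n).map_eq, integral_map (hpast n).aemeasurable]
    exact (hpast n).map_eq.symm ▸ hf.1
  have hsum : ∫ ω, ∑ n ∈ s, f (fun k : ℕ => x ω (n - k)) ∂P = s.card • ∫ z, f z ∂iid ℕ μ := by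
    simp only [integral_finsetSum s fun n _ => hint n, hmean, Finset.sum_const]
  have hcopy : AEStronglyMeasurable (∑ n ∈ s, copyDiff f n) (iid (Bool × ℤ) μ) :=
    (memLp_finsetSum' s fun n _ => memLp_copyDiff (memLp_one_iff_integrable.2 hf) n).1
  have hpair : (∑ n ∈ s, copyDiff f n) ∘ pairPath x = fun z : Ω × Ω =>
      ∑ n ∈ s, f (fun k : ℕ => x z.1 (n - k)) - ∑ n ∈ s, f (fun k : ℕ => x z.2 (n - k)) := by
    funext z
    rw [← Finset.sum_sub_distrib, Function.comp_apply, Finset.sum_apply]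
    rfl
  rw [← hsum, ← eLpNorm_comp_measurePreserving hcopy (measurePreserving_pairPath hx), hpair]
  exact eLpNorm_sub_integral_le (integrable_finsetSum s fun n _ => hint n)

theorem IsMApproximable.exists_eLpNorm_sum_sub_integral_le {G : Type*} [NormedAddCommGroup G]
    [InnerProductSpace ℝ G] {g : (ℕ → S) → G} (hg : IsMApproximable 2 μ g)
    (hx : MeasurePreserving x P (iid ℤ μ)) (L : G →L[ℝ] E) :
    ∃ c : ℝ, ∀ s : Finset ℤ, eLpNorm (fun ω => ∑ n ∈ s, L (g fun k : ℕ => x ω (n - k)) -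
      s.card • ∫ z, L (g z) ∂iid ℕ μ) 1 P ≤ ENNReal.ofReal (c * √s.card) := by
  obtain ⟨c, hc⟩ := hg.exists_eLpNorm_sum_copyDiff_le
  have hLg : Integrable (fun z => L (g z)) (iid ℕ μ) :=
    L.integrable_comp (hg.memLp.integrable one_le_two)
  refine ⟨‖L‖ * c, fun s => (eLpNorm_sum_sub_integral_le hLg hx s).trans ?_⟩
  have hcopy : AEStronglyMeasurable (∑ n ∈ s, copyDiff g n) (iid (Bool × ℤ) μ) :=
    (memLp_finsetSum' s fun n _ => memLp_copyDiff hg.memLp n).1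
  have hL : ∑ n ∈ s, copyDiff (fun z => L (g z)) n = fun y => L ((∑ n ∈ s, copyDiff g n) y) := by
    funext y
    simp only [Finset.sum_apply, map_sum, copyDiff, map_sub]
  calc eLpNorm (∑ n ∈ s, copyDiff (fun z => L (g z)) n) 1 (iid (Bool × ℤ) μ)
      ≤ ‖L‖ₑ * eLpNorm (∑ n ∈ s, copyDiff g n) 1 (iid (Bool × ℤ) μ) := by
        rw [hL]
        exact eLpNorm_le_mul_eLpNorm_of_ae_le_mul' (c := ‖L‖₊)
          (ae_of_all _ fun _ => L.le_opENorm _) 1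
    _ ≤ ‖L‖ₑ * ENNReal.ofReal (c * √s.card) := by
        gcongr
        exact (eLpNorm_le_eLpNorm_of_exponent_le one_le_two hcopy).trans (hc s)
    _ = ENNReal.ofReal (‖L‖ * c * √s.card) := by
        rw [← ofReal_norm, ← ENNReal.ofReal_mul (norm_nonneg _), mul_assoc]

end LawOfLargeNumbers

section EmpiricalMoments

variable {Ω : Type u} [MeasurableSpace Ω] {P : Measure Ω} [IsProbabilityMeasure P]
  {H : Type v} [NormedAddCommGroup H] [InnerProductSpace ℝ H] [MeasurableSpace H]
  {H' : Type*} [NormedAddCommGroup H'] [InnerProductSpace ℝ H'] {X : ℕ → Ω → H}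

instance holderTriple_four_four_two : ENNReal.HolderTriple 4 4 2 where
  inv_add_inv_eq_inv := by
    rw [← two_mul, show (4 : ℝ≥0∞) = 2 * 2 by norm_num,
      ENNReal.mul_inv (Or.inl two_ne_zero) (Or.inl ENNReal.ofNat_ne_top), ← mul_assoc,
      ENNReal.mul_inv_cancel two_ne_zero ENNReal.ofNat_ne_top, one_mul]

theorem integrable_empiricalCross {Ω : Type*} [MeasurableSpace Ω] {P : Measure Ω}
    {H₁ : Type*} [NormedAddCommGroup H₁] [InnerProductSpace ℝ H₁] {A : ℕ → Ω → H₁} {B : ℕ → Ω → H'}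
    (hA : ∀ k, 1 ≤ k → MemLp (A k) 2 P) (hB : ∀ k, 1 ≤ k → MemLp (B k) 2 P) (n : ℕ) :
    Integrable (empiricalCross A B n) P := by
  unfold empiricalCross
  refine (integrable_finsetSum _ fun k hk => ?_).smul (n : ℝ)⁻¹
  exact integrable_tensor (hA k (Finset.mem_Icc.1 hk).1) (hB k (Finset.mem_Icc.1 hk).1)

theorem tendstoInMeasure_smul_of_eLpNorm_le {ι E : Type*} [NormedAddCommGroup E] [NormedSpace ℝ E]
    {Ω : Type*} [MeasurableSpace Ω] {P : Measure Ω} {l : Filter ι} {p : ℝ≥0∞} (hp : p ≠ 0)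
    {F : ι → Ω → E} {r a : ι → ℝ} (hF : ∀ i, AEStronglyMeasurable (F i) P)
    (hFa : ∀ᶠ i in l, eLpNorm (F i) p P ≤ ENNReal.ofReal (a i))
    (hra : Tendsto (fun i => r i * a i) l (𝓝 0)) :
    TendstoInMeasure P (fun i ω => r i • F i ω) l fun _ => 0 := by
  refine tendstoInMeasure_of_tendsto_eLpNorm hp (fun i => (hF i).const_smul (r i))
    aestronglyMeasurable_const ?_
  have hlim : Tendsto (fun i => ENNReal.ofReal (|r i| * a i)) l (𝓝 0) := by
    refine ENNReal.ofReal_zero ▸ ENNReal.tendsto_ofReal ?_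
    rw [tendsto_zero_iff_norm_tendsto_zero] at hra ⊢
    simpa only [norm_mul, Real.norm_eq_abs, abs_abs] using hra
  refine tendsto_of_tendsto_of_tendsto_of_le_of_le' tendsto_const_nhds hlim
    (Eventually.of_forall fun _ => zero_le) ?_
  filter_upwards [hFa] with i hi
  calc eLpNorm ((fun ω => r i • F i ω) - fun _ => 0) p P = ‖r i‖ₑ * eLpNorm (F i) p P := by
        rw [← eLpNorm_const_smul]
        congr 1
        exact sub_zero _
    _ ≤ ‖r i‖ₑ * ENNReal.ofReal (a i) := mul_le_mul_right hi _
    _ = ENNReal.ofReal (|r i| * a i) := by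
        rw [← ofReal_norm, Real.norm_eq_abs, ← ENNReal.ofReal_mul (abs_nonneg _)]

namespace LpMApproximable

variable [OpensMeasurableSpace H] [SecondCountableTopology H]

open scoped TensorProduct in
theorem exists_tensor_ae_eq (hX : LpMApproximable.{u, v, w} 4 X P) (L₁ L₂ : H →L[ℝ] H') :
    ∃ (S : Type w) (_ : MeasurableSpace S) (μ : Measure S) (_ : IsProbabilityMeasure μ)
      (x : Ω → ℤ → S) (g : (ℕ → S) → H ⊗[ℝ] H'), MeasurePreserving x P (iid ℤ μ) ∧
        IsMApproximable 2 μ g ∧ ∀ k : ℕ, 1 ≤ k →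
          (fun ω => tensor (X k ω) (L₁ (X k ω) + L₂ (X (k + 1) ω))) =ᵐ[P]
            fun ω => tensorOperator (g fun i : ℕ => x ω ((k + 1 : ℕ) - i)) := by
  obtain ⟨S, _, μ, _, x, f, hx, hf, hXf⟩ := hX.exists_isMApproximable
  have hB := (hf.comp_tail.continuousLinearMap_comp L₁).add (by norm_num)
    (hf.continuousLinearMap_comp L₂)
  refine ⟨S, _, μ, ‹_›, x, _, hx, hf.comp_tail.tmul (q := 4) one_le_two hB, fun k hk => ?_⟩
  filter_upwards [hXf k hk, hXf (k + 1) (Nat.le_add_left 1 k)] with ω hω hω'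
  have htail : (fun i : ℕ => x ω ((k + 1 : ℕ) - i)) ∘ Nat.succ = fun i : ℕ => x ω (k - i) := by
    funext i
    simp
  rw [tensorOperator_tmul, htail, hω, hω']

variable [CompleteSpace H']

theorem exists_eLpNorm_sum_tensor_sub_le (hX : LpMApproximable.{u, v, w} 4 X P)
    (L₁ L₂ : H →L[ℝ] H') :
    ∃ c : ℝ, ∀ n : ℕ, eLpNorm (fun ω =>
      ∑ k ∈ Finset.Icc 1 n, tensor (X k ω) (L₁ (X k ω) + L₂ (X (k + 1) ω)) -
        n • ∫ ω', tensor (X 1 ω') (L₁ (X 1 ω') + L₂ (X 2 ω')) ∂P) 1 P ≤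
          ENNReal.ofReal (c * √n) := by
  obtain ⟨S, _, μ, _, x, g, hx, hg, hXg⟩ := hX.exists_tensor_ae_eq L₁ L₂
  obtain ⟨c, hc⟩ := hg.exists_eLpNorm_sum_sub_integral_le hx tensorOperator
  refine ⟨c, fun n => ?_⟩
  have hmean : ∫ ω, tensor (X 1 ω) (L₁ (X 1 ω) + L₂ (X 2 ω)) ∂P =
      ∫ z, tensorOperator (g z) ∂iid ℕ μ := by
    have hpast := measurePreserving_comp_sub hx ((1 + 1 : ℕ) : ℤ)
    rw [integral_congr_ae (hXg 1 le_rfl), ← hpast.map_eq, integral_map hpast.aemeasurable]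
    rw [hpast.map_eq]
    exact tensorOperator.continuous.comp_aestronglyMeasurable hg.memLp.1
  have hsucc : Function.Injective fun k : ℕ => ((k + 1 : ℕ) : ℤ) := fun _ _ h => by simpa using h
  have hn := hc ((Finset.Icc 1 n).map ⟨_, hsucc⟩)
  simp only [Finset.card_map, Nat.card_Icc, Nat.add_sub_cancel, Finset.sum_map,
    Function.Embedding.coeFn_mk, ← hmean] at hn
  refine (eLpNorm_congr_ae ?_).trans_le hn
  have hall := (Finset.Icc 1 n).eventually_all.2 fun k hk => hXg k (Finset.mem_Icc.1 hk).1
  filter_upwards [hall] with ω hω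
  rw [Finset.sum_congr rfl hω]

theorem exists_eLpNorm_empiricalCross_sub_le (hX : LpMApproximable.{u, v, w} 4 X P)
    (L₁ L₂ : H →L[ℝ] H') :
    ∃ c : ℝ, ∀ n : ℕ, 1 ≤ n → eLpNorm (fun ω =>
      empiricalCross X (fun k ω => L₁ (X k ω) + L₂ (X (k + 1) ω)) n ω -
        ∫ ω', tensor (X 1 ω') (L₁ (X 1 ω') + L₂ (X 2 ω')) ∂P) 1 P ≤ ENNReal.ofReal (c / √n) := by
  obtain ⟨c, hc⟩ := hX.exists_eLpNorm_sum_tensor_sub_le L₁ L₂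
  refine ⟨c, fun n hn => ?_⟩
  have hn' : (0 : ℝ) < n := by exact_mod_cast hn
  have hscale := mul_le_mul_right (hc n) ‖(n : ℝ)⁻¹‖ₑ
  rw [← eLpNorm_const_smul, ← ofReal_norm, ← ENNReal.ofReal_mul (norm_nonneg _), norm_inv,
    Real.norm_of_nonneg hn'.le, mul_left_comm, inv_mul_eq_div, Real.sqrt_div_self,
    ← div_eq_mul_inv] at hscale
  refine le_of_eq_of_le (congrArg (eLpNorm · 1 P) (funext fun ω => ?_)) hscale
  rw [Pi.smul_apply, smul_sub, ← Nat.cast_smul_eq_nsmul ℝ, inv_smul_smul₀ hn'.ne',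
    empiricalCross]

theorem tendstoInMeasure_smul_empiricalCross_sub (hX : LpMApproximable.{u, v, w} 4 X P)
    (L₁ L₂ : H →L[ℝ] H') {r : ℕ → ℝ} (hr : r =o[atTop] fun n : ℕ => √n) :
    TendstoInMeasure P (fun n ω => r n •
      (empiricalCross X (fun k ω => L₁ (X k ω) + L₂ (X (k + 1) ω)) n ω -
        ∫ ω', tensor (X 1 ω') (L₁ (X 1 ω') + L₂ (X 2 ω')) ∂P)) atTop fun _ => 0 := by
  obtain ⟨c, hc⟩ := hX.exists_eLpNorm_empiricalCross_sub_le L₁ L₂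
  have hX₂ : ∀ k, 1 ≤ k → MemLp (X k) 2 P := fun k hk => (hX.1 k hk).mono_exponent (by norm_num)
  have hB : ∀ k, 1 ≤ k → MemLp (fun ω => L₁ (X k ω) + L₂ (X (k + 1) ω)) 2 P := fun k hk =>
    (L₁.comp_memLp' (hX₂ k hk)).add (L₂.comp_memLp' (hX₂ (k + 1) (Nat.le_add_left 1 k)))
  refine tendstoInMeasure_smul_of_eLpNorm_le (E := H →L[ℝ] H') one_ne_zero
    (fun n => (integrable_empiricalCross hX₂ hB n).1.sub aestronglyMeasurable_const)
    ((eventually_ge_atTop 1).mono hc) ?_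
  have hlim := hr.tendsto_div_nhds_zero.const_mul c
  rw [mul_zero] at hlim
  exact hlim.congr fun n => by ring

end LpMApproximable

end EmpiricalMoments

section Covariance

variable {Ω : Type u} [MeasurableSpace Ω] {P : Measure Ω}
  {H : Type v} [NormedAddCommGroup H] [InnerProductSpace ℝ H] [CompleteSpace H]

theorem isPositive_integral {T : Ω → H →L[ℝ] H} (hT : ∀ ω, (T ω).IsPositive) :
    (∫ ω, T ω ∂P).IsPositive := by
  by_cases hint : Integrable T P
  · have hinner : ∀ x y : H, (inner ℝ x ((∫ ω, T ω ∂P) y) : ℝ) = ∫ ω, inner ℝ x (T ω y) ∂P :=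
      fun x y => by
        rw [ContinuousLinearMap.integral_apply hint,
          ← integral_inner (hint.apply_continuousLinearMap y)]
    refine (ContinuousLinearMap.isPositive_iff _).2 ⟨fun x y => ?_, fun x => ?_⟩
    · rw [ContinuousLinearMap.coe_coe, real_inner_comm, hinner, hinner]
      refine integral_congr_ae (ae_of_all _ fun ω => ?_)
      exact (real_inner_comm _ _).trans ((hT ω).inner_left_eq_inner_right x y)
    · rw [real_inner_comm, hinner]
      exact integral_nonneg fun ω => (hT ω).inner_nonneg_right x
  · rw [integral_undef hint]
    exact ContinuousLinearMap.isPositive_zero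

theorem covOperator_isPositive (U : Ω → H) : (covOperator U P).IsPositive :=
  isPositive_integral fun _ => InnerProductSpace.isPositive_rankOne_self _

namespace LpMApproximable

variable [IsProbabilityMeasure P] [MeasurableSpace H] [OpensMeasurableSpace H]
  [SecondCountableTopology H] {X : ℕ → Ω → H}

theorem tendstoInMeasure_empiricalCross_self (hX : LpMApproximable.{u, v, w} 4 X P)
    (hmean : ∫ ω, X 1 ω ∂P = 0) :
    TendstoInMeasure P (fun n ω => empiricalCross X X n ω) atTop
      fun _ => covOperator (X 1) P := by
  have hone : (fun _ : ℕ => (1 : ℝ)) =o[atTop] fun n : ℕ => √n :=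
    Asymptotics.isLittleO_const_left.2 <| Or.inr <| tendsto_norm_atTop_atTop.comp <|
      Real.tendsto_sqrt_atTop.comp tendsto_natCast_atTop_atTop
  have h := hX.tendstoInMeasure_smul_empiricalCross_sub (.id ℝ H) 0 hone
  rw [tendstoInMeasure_const_iff, tendsto_iff_norm_sub_tendsto_zero] at h ⊢
  simpa [covOperator, hmean] using h

theorem tendstoInMeasure_smul_empiricalCross_residual (hX : LpMApproximable.{u, v, w} 4 X P)
    {Ψ : H →L[ℝ] H} (horth : Orthogonal (X 1) (fun ω => X 2 ω - Ψ (X 1 ω)) P) {r : ℕ → ℝ}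
    (hr : r =o[atTop] fun n : ℕ => √n) :
    TendstoInMeasure P
      (fun n ω => r n • empiricalCross X (fun k ω => X (k + 1) ω - Ψ (X k ω)) n ω) atTop
      fun _ => 0 := by
  have hmean : ∫ ω, tensor (X 1 ω) (X 2 ω - Ψ (X 1 ω)) ∂P = 0 := horth
  simpa [neg_add_eq_sub, hmean] using
    hX.tendstoInMeasure_smul_empiricalCross_sub (-Ψ) (.id ℝ H) hr

end LpMApproximable

end Covariance

section Assumptions

variable {Ω : Type u} [MeasurableSpace Ω] {P : Measure Ω}

theorem isLittleO_sqrt_of_pow_six {m : ℕ → ℝ} (hm : Tendsto m atTop atTop)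
    (hm6 : (fun n => m n ^ 6) =o[atTop] fun n : ℕ => (n : ℝ)) :
    m =o[atTop] fun n : ℕ => √n := by
  refine .of_pow (n := 2) ((Asymptotics.IsBigO.of_bound' ?_).trans_isLittleO hm6 |>.congr_right ?_)
    two_ne_zero
  · filter_upwards [hm.eventually_ge_atTop 1] with n hn
    simpa only [Pi.pow_apply, norm_pow] using
      pow_le_pow_right₀ (hn.trans (Real.le_norm_self _)) (show 2 ≤ 6 by norm_num)
  · exact fun n => (Real.sq_sqrt n.cast_nonneg).symm

theorem IsARH1.orthogonal_residual {H : Type v} [NormedAddCommGroup H] [InnerProductSpace ℝ H]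
    {Ψ : H →L[ℝ] H} {X ε : ℕ → Ω → H} (h : IsARH1 Ψ X ε P) {n : ℕ} (hn : 1 ≤ n)
    (horth : Orthogonal (X n) (ε (n + 1)) P) :
    Orthogonal (X n) (fun ω => X (n + 1) ω - Ψ (X n ω)) P := by
  refine (integral_congr_ae ?_).trans horth
  filter_upwards [h n hn] with ω hω
  rw [hω, add_sub_cancel_left]

end Assumptions

end HilbertRegression

theorem corollary2_general
    {Ω : Type u} [MeasurableSpace Ω] {P : Measure Ω} [IsProbabilityMeasure P]
    {H : Type v} [NormedAddCommGroup H] [InnerProductSpace ℝ H] [CompleteSpace H]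
    [SecondCountableTopology H] [MeasurableSpace H] [OpensMeasurableSpace H]
    {Ψ : H →L[ℝ] H} (hΨ : hilbertSchmidtNorm Ψ < ∞) {X : ℕ → Ω → H}
    (hX : LpMApproximable.{u, v, w} 4 X P) (hmean : ∫ ω, X 1 ω ∂P = 0)
    (horth : Orthogonal (X 1) (fun ω => X 2 ω - Ψ (X 1 ω)) P)
    (hrank : DenseRange (covOperator (X 1) P))
    {lam : ℕ → ℝ} {v : ℕ → H} (hC : IsEigensystem (covOperator (X 1) P) lam v)
    (hlam : Function.Injective lam) {lamHat : ℕ → Ω → ℕ → ℝ} {vHat : ℕ → Ω → ℕ → H}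
    (hHat : ∀ n ω, IsEigensystem (empiricalCross X X n ω) (lamHat n ω) (vHat n ω))
    {m : ℕ → ℝ} (hm : Tendsto m atTop atTop) (hm_sqrt : m =o[atTop] fun n : ℕ => √n) :
    TendstoInMeasure P
      (fun n ω => pcEstimator (empiricalCross X (fun k => X (k + 1)) n ω) (lamHat n ω) (vHat n ω)
        (truncationLevel (lamHat n ω) (m n)))
      atTop (fun _ => Ψ) := by
  have hresidual := hX.tendstoInMeasure_smul_empiricalCross_residual horth hm_sqrt
  rw [tendstoInMeasure_const_iff, tendsto_zero_iff_norm_tendsto_zero] at hresidual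
  rw [tendstoInMeasure_const_iff]
  refine tendsto_pcEstimator hC (covOperator_isPositive _) hrank
    (hC.antitone.strictAnti_of_injective hlam) hΨ (fun p => hHat p.1 p.2)
    (fun p => empiricalCross_isPositive X p.1 p.2)
    (fun p => tendsto_eigenvalue_empiricalCross (hHat p.1 p.2))
    (tendstoInMeasure_const_iff.1 (hX.tendstoInMeasure_empiricalCross_self hmean))
    (hm.comp tendsto_fst_inMeasure) ?_
  simp only [empiricalCross_succ_sub_comp]
  rw [tendsto_zero_iff_norm_tendsto_zero]
  simpa only [norm_mul, norm_norm, norm_smul] using hresidual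

theorem corollary2
    {Ω : Type u} [MeasurableSpace Ω] (P : Measure Ω) [IsProbabilityMeasure P]
    {H : Type v} [NormedAddCommGroup H] [InnerProductSpace ℝ H] [CompleteSpace H]
    [TopologicalSpace.SeparableSpace H] [MeasurableSpace H] [BorelSpace H]
    (hdim : ¬ FiniteDimensional ℝ H)
    (Ψ : H →L[ℝ] H) (X ε : ℕ → Ω → H)
    -- the ARH(1) process, with Hilbert-Schmidt norm of `Ψ` less than one
    (hARH : IsARH1 Ψ X ε P)
    (hΨ : hilbertSchmidtNorm Ψ < 1)
    -- assumption (A) for the regression of `Y_k = X_{k+1}` on `X_k`, with errors `ε_{k+1}`;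
    -- it contains that the innovations are white noise
    (hA : AssumptionA.{u, v, v, w₁, w₂} X (fun k => ε (k + 1)) P)
    -- the covariance operator of `X_1` has full rank, and distinct eigenvalues `lam j`
    (hrank : DenseRange (covOperator (X 1) P))
    (lam : ℕ → ℝ) (v : ℕ → H) (hC : IsEigensystem (covOperator (X 1) P) lam v)
    (hdistinct : Function.Injective lam)
    -- any choice of eigenvalues and eigenvectors of the empirical covariance operators
    (lamHat : ℕ → Ω → ℕ → ℝ) (vHat : ℕ → Ω → ℕ → H)
    (hHat : ∀ n ω, IsEigensystem (empiricalCross X X n ω) (lamHat n ω) (vHat n ω))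
    -- assumption (K): `m_n → ∞` and `m_n ^ 6 = o(n)`
    (m : ℕ → ℝ) (hm : Tendsto m atTop atTop)
    (hm6 : (fun n => m n ^ 6) =o[atTop] (fun n : ℕ => (n : ℝ))) :
    TendstoInMeasure P
      (fun n ω => pcEstimator (empiricalCross X (fun k => X (k + 1)) n ω) (lamHat n ω) (vHat n ω)
        (truncationLevel (lamHat n ω) (m n)))
      atTop (fun _ => Ψ) := by
  have : SecondCountableTopology H := UniformSpace.secondCountable_of_separable H
  exact corollary2_general (hΨ.trans ENNReal.one_lt_top) hA.approximable_X (hA.mean_X 1 le_rfl)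
    (hARH.orthogonal_residual le_rfl (hA.orthogonal 1 le_rfl)) hrank hC hdistinct hHat hm
    (isLittleO_sqrt_of_pow_six hm hm6)
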